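/- Let INF (intuitionistic New Foundations) be the theory in first-order intuitionistic logic with equality, with the single binary relation symbol $\in$, whose axioms are extensionality, $\forall a,b\,(\forall x\,(x\in a\leftrightarrow x\in b)\to a=b)$, and stratified comprehension, $\exists y\,\forall x\,(x\in y\leftrightarrow\varphi)$ for every stratified formula $\varphi$ in which $y$ does not occur (parameters are allowed). A formula is stratified if natural-number indices can be assigned to its variables so that $y$ has index one more than $x$ in each subformula $x\in y$, and $x$, $y$ have the same index in each subformula $x=y$. In INF, let $\langle x,y\rangle=\{\{x\},\{x,y\}\}$; let $\mathsf{FUNC}$ be the class of all $f$ such that $\langle x,y\rangle\in f$ and $\langle x,z\rangle\in f$ imply $y=z$; and write $fx$ for $\{u:\exists y\,(\langle x,y\rangle\in f\wedge u\in y)\}$ (the value of $f$ at $x$ if $f\in\mathsf{FUNC}$ and $x$ is in the domain of $f$), associating to the left. Define - Church zero: $\mathbf 0=\{\langle f,\mathrm{id}\rangle : f=f\}$, where $\mathrm{id}=\{\langle x,x\rangle : x=x\}$; - Church successor: $\mathsf S=\{\langle z,\sigma(z)\rangle : z\in\mathsf{FUNC}\}$, where $\sigma(z)=\{\langle f,p_{z,f}\rangle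 : f\in\mathsf{FUNC}\}$ and $p_{z,f}=\{\langle x,w\rangle : \exists t,q\,(t\in\mathsf{FUNC}\wedge\langle f,t\rangle\in z\wedge\langle x,q\rangle\in t\wedge\langle q,w\rangle\in f)\}$ (so that $\mathsf S zfx=f(zfx)$); - the set $\mathbb N$ of Church numbers: the intersection of all sets $X$ such that $\mathbf 0\in X$ and $\mathsf S u\in X$ for all $u\in X$; - $\mathsf{FINITE}$: the intersection of all sets $w$ such that $\emptyset\in w$, and $u\cup\{c\}\in w$ whenever $u\in w$ and $c\notin u$. A set is finite if it belongs to $\mathsf{FINITE}$. The Church counting axiom is the (unstratified) sentence $\forall j\in\mathbb N\;(j\,\mathsf S\,\mathbf 0=j)$. **Theorem.** INF proves that the Church counting axiom implies that $\mathbb N$ is not finite; that is, the sentence $$\bigl(\forall j\in\mathbb N\;(j\,\mathsf S\,\mathbf 0=j)\bigr)\;\to\;\mathbb N\notin\mathsf{FINITE}$$ is derivable in INF, with intuitionistic logic. -/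

import Mathlib

namespace INF

/-! ### First-order formulas over membership, in de Bruijn form -/

/-- Formulas of intuitionistic first-order logic with equality over the single binary
relation symbol `∈`. Variables are de Bruijn indices: under a quantifier, `0` is the bound
variable and the variable called `i` outside is called `i + 1`. There are no other terms.
All connectives and both quantifiers are primitive, since intuitionistically none of them
is definable from the others. -/
inductive Formula : Type where
  /-- `x ∈ y` -/
  | mem (x y : ℕ) : Formula
  /-- `x = y` -/
  | eq (x y : ℕ) : Formula
  /-- falsity -/
  | bot : Formula
  /-- conjunction -/
  | and (φ ψ : Formula) : Formula
  /-- disjunction -/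
  | or (φ ψ : Formula) : Formula
  /-- implication -/
  | imp (φ ψ : Formula) : Formula
  /-- universal quantification over variable `0` -/
  | all (φ : Formula) : Formula
  /-- existential quantification over variable `0` -/
  | ex (φ : Formula) : Formula

/-- Extend an assignment on variables by a value for the newly bound variable `0`. -/
def scons {α : Type} (a : α) (σ : ℕ → α) : ℕ → α
  | 0 => a
  | i + 1 => σ i

/-- Push a renaming of variables under one quantifier. -/
def liftRen (ρ : ℕ → ℕ) : ℕ → ℕ := scons 0 (fun i => ρ i + 1)

namespace Formula

/-- Negation is implication of falsity. -/
def neg (φ : Formula) : Formula := imp φ bot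

/-- Logical equivalence. -/
def iff (φ ψ : Formula) : Formula := and (imp φ ψ) (imp ψ φ)

/-- Capture-free renaming of the free variables. As variables are the only terms, this is
also simultaneous substitution. -/
def rename : Formula → (ℕ → ℕ) → Formula
  | mem x y, ρ => mem (ρ x) (ρ y)
  | eq x y, ρ => eq (ρ x) (ρ y)
  | bot, _ => bot
  | and φ ψ, ρ => and (φ.rename ρ) (ψ.rename ρ)
  | or φ ψ, ρ => or (φ.rename ρ) (ψ.rename ρ)
  | imp φ ψ, ρ => imp (φ.rename ρ) (ψ.rename ρ)
  | all φ, ρ => all (φ.rename (liftRen ρ))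
  | ex φ, ρ => ex (φ.rename (liftRen ρ))

/-- Weakening by a fresh variable `0`. -/
def shift (φ : Formula) : Formula := φ.rename (fun i => i + 1)

/-- Substitute the variable `t` for the variable `0`, and lower all other variables. -/
def inst (φ : Formula) (t : ℕ) : Formula := φ.rename (scons t (fun i => i))

/-- `φ.StratWith σ`: the formula is stratified when the free variables receive the indices
given by `σ`. Every bound variable receives one index of its own; the two sides of an
equation have equal indices, and in `x ∈ y` the index of `y` is one more than that of `x`. -/
def StratWith : Formula → (ℕ → ℕ) → Prop
  | mem x y, σ => σ y = σ x + 1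
  | eq x y, σ => σ x = σ y
  | bot, _ => True
  | and φ ψ, σ => φ.StratWith σ ∧ ψ.StratWith σ
  | or φ ψ, σ => φ.StratWith σ ∧ ψ.StratWith σ
  | imp φ ψ, σ => φ.StratWith σ ∧ ψ.StratWith σ
  | all φ, σ => ∃ k : ℕ, φ.StratWith (scons k σ)
  | ex φ, σ => ∃ k : ℕ, φ.StratWith (scons k σ)

/-- A formula is stratified if some assignment of indices to its variables stratifies it. -/
def Stratified (φ : Formula) : Prop := ∃ σ : ℕ → ℕ, φ.StratWith σ

end Formula

open Formula

/-! ### Intuitionistic natural deduction -/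

/-- `Derives T Γ φ`: natural deduction for intuitionistic first-order logic with equality,
of `φ` from the list `Γ` of open assumptions and the nonlogical axioms `T`. In `allI` and
`exE` the eigenvariable is the fresh variable `0`, so the assumptions are shifted. Free
variables in a member of `T` are parameters: they are understood as universally quantified,
so that a member of `T` may be used under any eigenvariables. -/
inductive Derives (T : Set Formula) : List Formula → Formula → Prop where
  | ax {Γ : List Formula} {φ : Formula} : φ ∈ T → Derives T Γ φ
  | hyp {Γ : List Formula} {φ : Formula} : φ ∈ Γ → Derives T Γ φ
  | botE {Γ : List Formula} {φ : Formula} : Derives T Γ bot → Derives T Γ φ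
  | andI {Γ : List Formula} {φ ψ : Formula} :
      Derives T Γ φ → Derives T Γ ψ → Derives T Γ (and φ ψ)
  | andE₁ {Γ : List Formula} {φ ψ : Formula} : Derives T Γ (and φ ψ) → Derives T Γ φ
  | andE₂ {Γ : List Formula} {φ ψ : Formula} : Derives T Γ (and φ ψ) → Derives T Γ ψ
  | orI₁ {Γ : List Formula} {φ ψ : Formula} : Derives T Γ φ → Derives T Γ (or φ ψ)
  | orI₂ {Γ : List Formula} {φ ψ : Formula} : Derives T Γ ψ → Derives T Γ (or φ ψ)
  | orE {Γ : List Formula} {φ ψ χ : Formula} : Derives T Γ (or φ ψ) →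
      Derives T (φ :: Γ) χ → Derives T (ψ :: Γ) χ → Derives T Γ χ
  | impI {Γ : List Formula} {φ ψ : Formula} : Derives T (φ :: Γ) ψ → Derives T Γ (imp φ ψ)
  | impE {Γ : List Formula} {φ ψ : Formula} :
      Derives T Γ (imp φ ψ) → Derives T Γ φ → Derives T Γ ψ
  | allI {Γ : List Formula} {φ : Formula} :
      Derives T (Γ.map shift) φ → Derives T Γ (all φ)
  | allE {Γ : List Formula} {φ : Formula} (t : ℕ) :
      Derives T Γ (all φ) → Derives T Γ (φ.inst t)
  | exI {Γ : List Formula} {φ : Formula} (t : ℕ) :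
      Derives T Γ (φ.inst t) → Derives T Γ (ex φ)
  | exE {Γ : List Formula} {φ ψ : Formula} : Derives T Γ (ex φ) →
      Derives T (φ :: Γ.map shift) ψ.shift → Derives T Γ ψ
  | eqRefl {Γ : List Formula} (t : ℕ) : Derives T Γ (eq t t)
  | eqSubst {Γ : List Formula} {φ : Formula} {s t : ℕ} :
      Derives T Γ (eq s t) → Derives T Γ (φ.inst s) → Derives T Γ (φ.inst t)

/-! ### The theory INF -/

/-- Extensionality: `∀ a b, (∀ x, x ∈ a ↔ x ∈ b) → a = b`. -/
def extensionality : Formula :=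
  all (all (imp (all (iff (mem 0 2) (mem 0 1))) (eq 1 0)))

/-- The comprehension instance `∃ y, ∀ x, (x ∈ y ↔ φ)`. The variable `0` of `φ` is `x`, its
other variables are parameters, and `y` does not occur in `φ`. -/
def comprehension (φ : Formula) : Formula :=
  ex (all (iff (mem 0 1) (φ.rename (liftRen (fun i => i + 1)))))

/-- The axioms of INF: extensionality, and comprehension for stratified formulas. -/
def theory : Set Formula :=
  {extensionality} ∪ {ψ | ∃ φ : Formula, φ.Stratified ∧ ψ = comprehension φ}

/-! ### Set-theoretic notions

The arguments of the following formulas are the names of free variables. -/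

/-- `s = {a, b}` -/
def isUPair (s a b : ℕ) : Formula :=
  all (iff (mem 0 (s + 1)) (or (eq 0 (a + 1)) (eq 0 (b + 1))))

/-- `p = ⟨x, y⟩`, that is `p = {{x}, {x, y}}`.
Bound variables: `1` is `{x}`, `0` is `{x, y}`. -/
def isOPair (p x y : ℕ) : Formula :=
  ex (ex (and (isUPair 1 (x + 2) (x + 2)) (and (isUPair 0 (x + 2) (y + 2)) (isUPair (p + 2) 1 0))))

/-- `⟨x, y⟩ ∈ f` -/
def pairMem (x y f : ℕ) : Formula :=
  ex (and (isOPair 0 (x + 1) (y + 1)) (mem 0 (f + 1)))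

/-- `f ∈ FUNC`, that is `∀ x y z, ⟨x, y⟩ ∈ f → ⟨x, z⟩ ∈ f → y = z`.
Bound variables: `x` is `2`, `y` is `1`, `z` is `0`. -/
def isFunc (f : ℕ) : Formula :=
  all (all (all (imp (pairMem 2 1 (f + 3)) (imp (pairMem 2 0 (f + 3)) (eq 1 0)))))

/-- `v = Ap(f, x)`, that is `v = {u | ∃ y, ⟨x, y⟩ ∈ f ∧ u ∈ y}`; this is the value of `f` at
`x` when `f ∈ FUNC` and `x` is in the domain of `f`.
Bound variables: first `u` is `0`; then `u` is `1` and `y` is `0`. -/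
def isAp (v f x : ℕ) : Formula :=
  all (iff (mem 0 (v + 1)) (ex (and (pairMem (x + 2) 0 (f + 2)) (mem 1 0))))

/-- `i` is the identity function `{⟨x, x⟩ | x = x}`. -/
def isId (i : ℕ) : Formula :=
  all (iff (mem 0 (i + 1)) (ex (isOPair 1 0 0)))

/-- `o` is Church zero, `{⟨f, id⟩ | f = f}`.
Bound variables: the element is `2`, `f` is `1`, `id` is `0`. -/
def isZero (o : ℕ) : Formula :=
  all (iff (mem 0 (o + 1)) (ex (ex (and (isId 0) (isOPair 2 1 0)))))

/-- `p = {⟨x, w⟩ | ∃ t q, t ∈ FUNC ∧ ⟨f, t⟩ ∈ z ∧ ⟨x, q⟩ ∈ t ∧ ⟨q, w⟩ ∈ f}`, the function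
taking `x` to `f (z f x)`.
Bound variables: the element is `4`, `x` is `3`, `w` is `2`, `t` is `1`, `q` is `0`. -/
def isSuccMap (p z f : ℕ) : Formula :=
  all (iff (mem 0 (p + 1))
    (ex (ex (ex (ex (and (isOPair 4 3 2) (and (isFunc 1)
      (and (pairMem (f + 5) 1 (z + 5)) (and (pairMem 3 0 1) (pairMem 0 2 (f + 5)))))))))))

/-- `s = {⟨f, p⟩ | f ∈ FUNC ∧ p is the function taking x to f (z f x)}`.
Bound variables: the element is `2`, `f` is `1`, `p` is `0`. -/
def isSuccValue (s z : ℕ) : Formula :=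
  all (iff (mem 0 (s + 1))
    (ex (ex (and (isOPair 2 1 0) (and (isFunc 1) (isSuccMap 0 (z + 3) 1))))))

/-- `S` is Church successor, the set of pairs `⟨z, {⟨f, p⟩ | …}⟩` with `z ∈ FUNC`.
Bound variables: the element is `2`, `z` is `1`, its successor is `0`. -/
def isSucc (S : ℕ) : Formula :=
  all (iff (mem 0 (S + 1))
    (ex (ex (and (isOPair 2 1 0) (and (isFunc 1) (isSuccValue 0 1))))))

/-- `X` contains `o` and is closed under `S`: `o ∈ X ∧ ∀ u, u ∈ X → ∃ v, v = S u ∧ v ∈ X`.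
Bound variables: `u` is `1`, `v` is `0`. -/
def isInductive (X o S : ℕ) : Formula :=
  and (mem o X)
    (all (imp (mem 0 (X + 1)) (ex (and (isAp 0 (S + 2) 1) (mem 0 (X + 2))))))

/-- `x` is a Church number: it belongs to every set that contains Church zero and is closed
under Church successor.
Bound variables: Church zero is `1` and Church successor is `0`; under the last quantifier,
they are `2` and `1`, and the set is `0`. -/
def isChurchNumber (x : ℕ) : Formula :=
  ex (ex (and (isZero 1) (and (isSucc 0) (all (imp (isInductive 0 2 1) (mem (x + 3) 0))))))

/-- `n` is the set `ℕ` of Church numbers. -/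
def isN (n : ℕ) : Formula :=
  all (iff (mem 0 (n + 1)) (isChurchNumber 0))

/-- `e` is the empty set. -/
def isEmpty (e : ℕ) : Formula := all (neg (mem 0 (e + 1)))

/-- `v = u ∪ {c}` -/
def isAdjoin (v u c : ℕ) : Formula :=
  all (iff (mem 0 (v + 1)) (or (mem 0 (u + 1)) (eq 0 (c + 1))))

/-- `w` contains the empty set and contains `u ∪ {c}` whenever `u ∈ w` and `c ∉ u`.
Bound variables in the second part: `u` is `2`, `c` is `1`, `u ∪ {c}` is `0`. -/
def isFinClosed (w : ℕ) : Formula :=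
  and (ex (and (isEmpty 0) (mem 0 (w + 1))))
    (all (all (imp (and (mem 1 (w + 2)) (neg (mem 0 1)))
      (ex (and (isAdjoin 0 2 1) (mem 0 (w + 3)))))))

/-- `F` is the set `FINITE` of finite sets, the intersection of all sets that contain the
empty set and contain `u ∪ {c}` whenever they contain `u` and `c ∉ u`. -/
def isFINITE (F : ℕ) : Formula :=
  all (iff (mem 0 (F + 1)) (all (imp (isFinClosed 0) (mem 1 0))))

/-! ### The two sentences -/

/-- The Church counting axiom `∀ j ∈ ℕ, j S 0 = j`, where `j S 0` is `Ap(Ap(j, S), 0)`.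
Bound variables: `ℕ` is `2`, `S` is `1`, Church zero is `0`; then `j` is added, and then
`Ap(j, S)`, so that finally `Ap(j, S)` is `0`, `j` is `1`, Church zero is `2` and `S` is `3`. -/
def churchCounting : Formula :=
  ex (ex (ex (and (isN 2) (and (isSucc 1) (and (isZero 0)
    (all (imp (mem 0 3) (ex (and (isAp 0 1 3) (isAp 1 0 2))))))))))

/-- The sentence `ℕ ∉ FINITE`. Bound variables: `ℕ` is `1`, `FINITE` is `0`. -/
def churchNumbersNotFinite : Formula :=
  ex (ex (and (isN 1) (and (isFINITE 0) (neg (mem 1 0)))))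

end INF

/-! The derivation is obtained semantically. Intuitionistic natural deduction is complete for Kripke
models over a category of worlds (`derives_of_forces`), so it suffices to take a Kripke model of INF
and a world forcing the counting axiom, and to refute there that ℕ is finite. The metatheory is
classical. Inside the model, comprehension and induction are limited to stratified formulas, and a
case distinction must either be forced or lead to a contradiction, possibly at a later world.

Suppose ℕ is finite. Finite sets have decidable equality and satisfy a pigeonhole principle
(`IsFinite.decEq`, `IsFinite.pigeonhole`). Church successor S maps ℕ into ℕ and never takes the
value 0, so a contradiction follows once S is injective on ℕ (`succVal_injective`).

Let S a = S b with a ≠ b, and let f_b be S on ℕ with its value at b changed to 0. By counting, j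
steps of S from 0 lead to j. As f_b agrees with S until b is reached, b f_b 0 = b, hence (S b) f_b 0
= 0. Since S a = S b, also f_b(a f_b 0) = 0; only b is sent to 0, so a f_b 0 = b. Symmetrically b
f_a 0 = a. Now u f_b 0 = u f_a 0 = u S 0 = u follows by induction on u: the step could fail only at
u = a or u = b, where the induction hypothesis gives a f_b 0 = a or b f_a 0 = b, which is absurd.
Taking u = a gives a = a f_b 0 = b.

In u f x, the index of u is six above that of the value, so "the value is u" cannot be part of an
induction formula. The formulas compare iterates with u S 0 instead, and the counting axiom
identifies this with u from outside. -/

namespace INF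
open Formula

/-! ### Renaming -/

theorem liftRen_comp (ρ τ : ℕ → ℕ) : liftRen τ ∘ liftRen ρ = liftRen (τ ∘ ρ) := by
  funext i; cases i <;> rfl

theorem comp_scons {α β : Type} (f : α → β) (a : α) (v : ℕ → α) :
    f ∘ scons a v = scons (f a) (f ∘ v) := by
  funext i; cases i <;> rfl

theorem scons_comp_liftRen {α : Type} (a : α) (v : ℕ → α) (ρ : ℕ → ℕ) :
    scons a v ∘ liftRen ρ = scons a (v ∘ ρ) := by
  funext i; cases i <;> rfl

theorem rename_rename (φ : Formula) (ρ τ : ℕ → ℕ) :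
    (φ.rename ρ).rename τ = φ.rename (τ ∘ ρ) := by
  induction φ generalizing ρ τ <;> simp_all [rename, liftRen_comp]

theorem liftRen_id : liftRen id = id := by
  funext i; cases i <;> rfl

theorem rename_id (φ : Formula) : φ.rename id = φ := by
  induction φ <;> simp_all [rename, liftRen_id]

theorem inst_rename (φ : Formula) (t : ℕ) (ρ : ℕ → ℕ) :
    (φ.inst t).rename ρ = (φ.rename (liftRen ρ)).inst (ρ t) := by
  simp only [inst, rename_rename]
  congr 1; funext i; cases i <;> rfl

theorem rename_liftRen_inst (φ : Formula) (t : ℕ) (ρ : ℕ → ℕ) :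
    (φ.rename (liftRen ρ)).inst t = φ.rename (scons t ρ) := by
  simp only [inst, rename_rename]
  congr 1; funext i; cases i <;> rfl

theorem shift_rename (φ : Formula) (ρ : ℕ → ℕ) :
    φ.shift.rename (liftRen ρ) = (φ.rename ρ).shift := by
  simp only [shift, rename_rename]
  congr 1

/-- The renaming of a formula depends on finitely many values only. -/
theorem exists_rename_congr (φ : Formula) :
    ∃ n, ∀ ρ τ : ℕ → ℕ, (∀ i < n, ρ i = τ i) → φ.rename ρ = φ.rename τ := by
  have lift {n : ℕ} {ρ τ : ℕ → ℕ} (h : ∀ i < n, ρ i = τ i) : ∀ i < n, liftRen ρ i = liftRen τ i := by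
    intro i hi
    cases i with
    | zero => rfl
    | succ i => simp [liftRen, scons, h i (by omega)]
  induction φ with
  | mem x y => exact ⟨x + y + 1, fun ρ τ h => by simp [rename, h x (by omega), h y (by omega)]⟩
  | eq x y => exact ⟨x + y + 1, fun ρ τ h => by simp [rename, h x (by omega), h y (by omega)]⟩
  | bot => exact ⟨0, fun _ _ _ => rfl⟩
  | and φ ψ h₁ h₂ | or φ ψ h₁ h₂ | imp φ ψ h₁ h₂ =>
    obtain ⟨m, hm⟩ := h₁
    obtain ⟨n, hn⟩ := h₂
    refine ⟨m + n, fun ρ τ h => ?_⟩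
    simp [rename, hm ρ τ fun i hi => h i (by omega), hn ρ τ fun i hi => h i (by omega)]
  | all φ h | ex φ h =>
    obtain ⟨n, hn⟩ := h
    exact ⟨n, fun ρ τ h => by simp [rename, hn _ _ (lift h)]⟩

/-- The variable `t` is not free in `φ`. -/
def Fresh (t : ℕ) (φ : Formula) : Prop :=
  ∀ ρ τ : ℕ → ℕ, (∀ i, i ≠ t → ρ i = τ i) → φ.rename ρ = φ.rename τ

theorem exists_fresh (φ : Formula) : ∃ n, ∀ t, n ≤ t → Fresh t φ := by
  obtain ⟨n, hn⟩ := exists_rename_congr φ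
  exact ⟨n, fun t ht ρ τ h => hn ρ τ fun i hi => h i (by omega)⟩

theorem fresh_rename {t : ℕ} {ρ : ℕ → ℕ} (h : ∀ i, ρ i ≠ t) (φ : Formula) :
    Fresh t (φ.rename ρ) := by
  intro σ τ hσ
  simp only [rename_rename]
  congr 1; funext i; exact hσ _ (h i)

/-! ### Structural properties of derivations -/

theorem Derives.weaken {T : Set Formula} {Γ Δ : List Formula} {φ : Formula}
    (h : Derives T Γ φ) (hΔ : Γ ⊆ Δ) : Derives T Δ φ := by
  induction h generalizing Δ with
  | ax h => exact .ax h
  | hyp h => exact .hyp (hΔ h)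
  | botE _ ih => exact .botE (ih hΔ)
  | andI _ _ ih₁ ih₂ => exact .andI (ih₁ hΔ) (ih₂ hΔ)
  | andE₁ _ ih => exact .andE₁ (ih hΔ)
  | andE₂ _ ih => exact .andE₂ (ih hΔ)
  | orI₁ _ ih => exact .orI₁ (ih hΔ)
  | orI₂ _ ih => exact .orI₂ (ih hΔ)
  | orE _ _ _ ih ih₁ ih₂ =>
    exact .orE (ih hΔ) (ih₁ (List.cons_subset_cons _ hΔ)) (ih₂ (List.cons_subset_cons _ hΔ))
  | impI _ ih => exact .impI (ih (List.cons_subset_cons _ hΔ))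
  | impE _ _ ih₁ ih₂ => exact .impE (ih₁ hΔ) (ih₂ hΔ)
  | allI _ ih => exact .allI (ih (List.map_subset _ hΔ))
  | allE t _ ih => exact .allE t (ih hΔ)
  | exI t _ ih => exact .exI t (ih hΔ)
  | exE _ _ ih₁ ih₂ => exact .exE (ih₁ hΔ) (ih₂ (List.cons_subset_cons _ (List.map_subset _ hΔ)))
  | eqRefl t => exact .eqRefl t
  | eqSubst _ _ ih₁ ih₂ => exact .eqSubst (ih₁ hΔ) (ih₂ hΔ)

/-- The rule `ax` yields an axiom only with its own variable names. Other names for its parameters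
come from generalizing and instantiating one variable after another; finitely many matter. -/
theorem Derives.rename_of_forall {T : Set Formula} {φ : Formula} (h : ∀ Γ, Derives T Γ φ)
    (ρ : ℕ → ℕ) (Γ : List Formula) : Derives T Γ (φ.rename ρ) := by
  have key : ∀ (ts : List ℕ) (φ : Formula), (∀ Γ, Derives T Γ φ) →
      ∀ Γ, Derives T Γ (φ.rename (ts.foldr scons id)) := by
    intro ts
    induction ts with
    | nil => intro φ h Γ; simpa [rename_id] using h Γ
    | cons t ts ih =>
      intro φ h Γ
      have := (ih (all φ) (fun Γ => .allI (h _)) Γ).allE t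
      rwa [rename_liftRen_inst] at this
  obtain ⟨n, hn⟩ := exists_rename_congr φ
  have agree : ∀ (n : ℕ) (ρ : ℕ → ℕ), ∀ i < n, ρ i = ((List.range n).map ρ).foldr scons id i := by
    intro n
    induction n with
    | zero => intro ρ i hi; omega
    | succ n ih =>
      intro ρ i hi
      rw [List.range_succ_eq_map]
      cases i with
      | zero => rfl
      | succ i => simpa [scons, Function.comp_def] using ih (fun i => ρ (i + 1)) i (by omega)
  rw [hn ρ _ (agree n ρ)]
  exact key _ φ h Γ

theorem Derives.rename {T : Set Formula} {Γ : List Formula} {φ : Formula} (h : Derives T Γ φ)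
    (ρ : ℕ → ℕ) : Derives T (Γ.map (·.rename ρ)) (φ.rename ρ) := by
  have map_shift (Γ : List Formula) (ρ : ℕ → ℕ) :
      (Γ.map shift).map (·.rename (liftRen ρ)) = (Γ.map (·.rename ρ)).map shift := by
    simp [shift_rename]
  induction h generalizing ρ with
  | ax h => exact .rename_of_forall (fun _ => .ax h) _ _
  | hyp h => exact .hyp (List.mem_map_of_mem h)
  | botE _ ih => exact .botE (ih ρ)
  | andI _ _ ih₁ ih₂ => exact .andI (ih₁ ρ) (ih₂ ρ)
  | andE₁ _ ih => exact .andE₁ (ih ρ)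
  | andE₂ _ ih => exact .andE₂ (ih ρ)
  | orI₁ _ ih => exact .orI₁ (ih ρ)
  | orI₂ _ ih => exact .orI₂ (ih ρ)
  | orE _ _ _ ih ih₁ ih₂ => exact .orE (ih ρ) (ih₁ ρ) (ih₂ ρ)
  | impI _ ih => exact .impI (ih ρ)
  | impE _ _ ih₁ ih₂ => exact .impE (ih₁ ρ) (ih₂ ρ)
  | allI _ ih => exact .allI (map_shift _ ρ ▸ ih (liftRen ρ))
  | allE t _ ih => rw [inst_rename]; exact .allE _ (ih ρ)
  | exI t _ ih => exact .exI (ρ t) (by rw [← inst_rename]; exact ih ρ)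
  | exE _ _ ih₁ ih₂ =>
    refine .exE (ih₁ ρ) ?_
    have := ih₂ (liftRen ρ)
    rwa [List.map_cons, map_shift, shift_rename] at this
  | eqRefl t => exact .eqRefl _
  | eqSubst _ _ ih₁ ih₂ =>
    rw [inst_rename]
    exact .eqSubst (ih₁ ρ) (by rw [← inst_rename]; exact ih₂ ρ)

theorem Derives.hyp₀ {T : Set Formula} {Γ : List Formula} {φ : Formula} : Derives T (φ :: Γ) φ :=
  .hyp List.mem_cons_self

theorem Derives.hyp₁ {T : Set Formula} {Γ : List Formula} {φ ψ : Formula} :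
    Derives T (ψ :: φ :: Γ) φ :=
  .hyp (List.mem_cons_of_mem _ List.mem_cons_self)

/-- Derivability from a possibly infinite set of assumptions. -/
def SetDerives (T A : Set Formula) (φ : Formula) : Prop :=
  ∃ L : List Formula, (∀ ψ ∈ L, ψ ∈ A) ∧ Derives T L φ

theorem SetDerives.mono {T A B : Set Formula} {φ : Formula} (h : SetDerives T A φ) (hAB : A ⊆ B) :
    SetDerives T B φ := by
  obtain ⟨L, hL, hd⟩ := h
  exact ⟨L, fun ψ hψ => hAB (hL ψ hψ), hd⟩

theorem SetDerives.exists_of_insert {T A : Set Formula} {φ χ : Formula}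
    (h : SetDerives T (insert φ A) χ) :
    ∃ L : List Formula, (∀ ψ ∈ L, ψ ∈ A) ∧ Derives T (φ :: L) χ := by
  classical
  obtain ⟨L, hL, hd⟩ := h
  refine ⟨L.filter (· ≠ φ), fun ψ hψ => ?_, hd.weaken fun ψ hψ => ?_⟩
  · simp only [List.mem_filter, decide_eq_true_eq] at hψ
    exact (hL ψ hψ.1).resolve_left hψ.2
  · by_cases h : ψ = φ
    · simp [h]
    · simp [h, hψ]

theorem SetDerives.cut {T A : Set Formula} {φ χ : Formula} (h : SetDerives T (insert φ A) χ)
    (hφ : SetDerives T A φ) : SetDerives T A χ := by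
  obtain ⟨L, hL, hd⟩ := h.exists_of_insert
  obtain ⟨L', hL', hd'⟩ := hφ
  refine ⟨L ++ L', fun ψ hψ => (List.mem_append.1 hψ).elim (hL ψ) (hL' ψ), ?_⟩
  exact .impE (.impI (hd.weaken (by simp))) (hd'.weaken (by simp))

/-! ### Countability of the set of formulas -/

/-- A numbering of the formulas. -/
def code : Formula → ℕ
  | .mem x y => 8 * Nat.pair x y
  | .eq x y => 8 * Nat.pair x y + 1
  | .bot => 2
  | .and φ ψ => 8 * Nat.pair (code φ) (code ψ) + 3
  | .or φ ψ => 8 * Nat.pair (code φ) (code ψ) + 4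
  | .imp φ ψ => 8 * Nat.pair (code φ) (code ψ) + 5
  | .all φ => 8 * code φ + 6
  | .ex φ => 8 * code φ + 7

theorem code_injective : Function.Injective code := by
  intro φ
  induction φ with
  | mem x y | eq x y =>
    intro ψ h
    cases ψ <;> simp only [code] at h <;> first | omega | skip
    simp only [Nat.add_right_cancel_iff, Nat.mul_right_inj (show 8 ≠ 0 by simp),
      Nat.pair_eq_pair] at h
    simp [h]
  | bot => intro ψ h; cases ψ <;> simp only [code] at h <;> first | omega | rfl
  | and φ ψ h₁ h₂ | or φ ψ h₁ h₂ | imp φ ψ h₁ h₂ =>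
    intro θ h
    cases θ <;> simp only [code] at h <;> first | omega | skip
    simp only [Nat.add_right_cancel_iff, Nat.mul_right_inj (show 8 ≠ 0 by simp),
      Nat.pair_eq_pair] at h
    rw [h₁ h.1, h₂ h.2]
  | all φ ih | ex φ ih =>
    intro θ h
    cases θ <;> simp only [code] at h <;> first | omega | skip
    simp only [Nat.add_right_cancel_iff, Nat.mul_right_inj (show 8 ≠ 0 by simp)] at h
    rw [ih h]

/-! ### Saturated theories -/

/-- A deductively closed, consistent, prime theory with witnesses for existential formulas. -/
structure Saturated (T : Set Formula) where
  carrier : Set Formula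
  closed : ∀ {φ}, SetDerives T carrier φ → φ ∈ carrier
  consistent : bot ∉ carrier
  prime : ∀ {φ ψ}, Formula.or φ ψ ∈ carrier → φ ∈ carrier ∨ ψ ∈ carrier
  witness : ∀ {φ}, ex φ ∈ carrier → ∃ t, φ.inst t ∈ carrier

/-- `A` does not derive `χ`, and almost all odd variables are fresh for `A`. -/
def Extendable (T : Set Formula) (χ : Formula) (A : Set Formula) : Prop :=
  ¬ SetDerives T A χ ∧ ∃ n, ∀ t, n ≤ t → Odd t → ∀ θ ∈ A, Fresh t θ

theorem Extendable.insert_formula {T : Set Formula} {χ θ : Formula} {A : Set Formula}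
    (h : Extendable T χ A) (hd : ¬ SetDerives T (insert θ A) χ) : Extendable T χ (insert θ A) := by
  obtain ⟨_, n, hn⟩ := h
  obtain ⟨m, hm⟩ := exists_fresh θ
  refine ⟨hd, n + m, fun t ht ho ψ hψ => ?_⟩
  rcases hψ with rfl | hψ
  · exact hm t (by omega)
  · exact hn t (by omega) ho ψ hψ

/-- A fresh variable as witness adds no consequences among formulas that do not mention it: a
derivation using it turns into an application of `exE`. -/
theorem Extendable.insert_witness {T : Set Formula} {χ φ : Formula} {A : Set Formula}
    (h : Extendable T χ A) (hex : ex φ ∈ A) : ∃ t, Extendable T χ (insert (φ.inst t) A) := by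
  obtain ⟨hA, n, hn⟩ := id h
  obtain ⟨m, hm⟩ := exists_fresh χ
  obtain ⟨k, hk⟩ := exists_fresh φ
  -- Odd and beyond all three bounds, so fresh for `A`, for `χ` and for `ex φ`.
  let t := 2 * (n + m + k) + 1
  refine ⟨t, h.insert_formula fun hd => hA ?_⟩
  obtain ⟨L, hL, hd⟩ := hd.exists_of_insert
  refine ⟨ex φ :: L, by simpa [hex] using hL, .exE .hyp₀ ?_⟩
  -- Turns the witness into the eigenvariable `0` and acts as the shift on every other variable.
  let ρ : ℕ → ℕ := fun i => if i = t then 0 else i + 1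
  have hρ {ψ : Formula} (hψ : Fresh t ψ) : ψ.rename ρ = ψ.shift :=
    hψ _ _ fun i hi => by simp [ρ, hi]
  have hφ : (φ.inst t).rename ρ = φ := by
    conv_rhs => rw [← rename_id φ]
    rw [inst, rename_rename]
    refine hk (t + 1) (by omega) _ _ fun i hi => ?_
    cases i with
    | zero => simp [scons, ρ]
    | succ i => simp [scons, ρ, show i ≠ t by omega]
  have := hd.rename ρ
  rw [List.map_cons, hφ, hρ (hm t (by omega)),
    List.map_congr_left fun ψ hψ => hρ (hn t (by omega) ⟨_, rfl⟩ ψ (hL ψ hψ))] at this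
  exact this.weaken (by intro ψ; simp; tauto)

/-- An existential formula receives its witness at the stage that adds it, so a single pass through
an enumeration of all formulas saturates the set. -/
theorem Extendable.step {T : Set Formula} {χ : Formula} {A : Set Formula}
    (h : Extendable T χ A) (θ : Formula) :
    ∃ B, Extendable T χ B ∧ A ⊆ B ∧ (SetDerives T (insert θ A) χ ∨
      θ ∈ B ∧ ∀ φ, θ = ex φ → ∃ t, φ.inst t ∈ B) := by
  by_cases hd : SetDerives T (insert θ A) χ
  · exact ⟨A, h, subset_rfl, .inl hd⟩
  have h' := h.insert_formula hd
  by_cases hθ : ∃ φ, θ = ex φ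
  · obtain ⟨φ, rfl⟩ := hθ
    obtain ⟨t, ht⟩ := h'.insert_witness (Set.mem_insert _ _)
    refine ⟨_, ht, (Set.subset_insert _ _).trans (Set.subset_insert _ _), .inr ⟨by simp, ?_⟩⟩
    rintro _ ⟨⟩
    exact ⟨t, by simp⟩
  · exact ⟨_, h', Set.subset_insert _ _, .inr ⟨by simp, fun φ hφ => (hθ ⟨φ, hφ⟩).elim⟩⟩

theorem exists_saturated_of_extendable {T : Set Formula} {χ : Formula} {A : Set Formula}
    (h : Extendable T χ A) : ∃ G : Saturated T, A ⊆ G.carrier ∧ χ ∉ G.carrier := by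
  have : Countable Formula := code_injective.countable
  have : Nonempty Formula := ⟨bot⟩
  obtain ⟨enum, henum⟩ := exists_surjective_nat Formula
  choose next hnext using fun (B : {B // Extendable T χ B}) θ => B.2.step θ
  let chain : ℕ → {B // Extendable T χ B} :=
    fun n => n.rec ⟨A, h⟩ fun n B => ⟨next B (enum n), (hnext B (enum n)).1⟩
  have hmono : Monotone fun n => (chain n).1 :=
    monotone_nat_of_le_succ fun n => (hnext (chain n) (enum n)).2.1
  let G : Set Formula := ⋃ n, (chain n).1
  have sub (n) : (chain n).1 ⊆ G := Set.subset_iUnion (fun n => (chain n).1) n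
  have hG : ¬ SetDerives T G χ := by
    rintro ⟨L, hL, hd⟩
    have : ∃ n, ∀ ψ ∈ L, ψ ∈ (chain n).1 := by
      clear hd
      induction L with
      | nil => exact ⟨0, by simp⟩
      | cons φ L ih =>
        obtain ⟨n, hn⟩ := ih fun ψ hψ => hL ψ (by simp [hψ])
        obtain ⟨m, hm⟩ := Set.mem_iUnion.1 (hL φ (by simp))
        refine ⟨max n m, fun ψ hψ => ?_⟩
        rcases List.mem_cons.1 hψ with rfl | hψ
        · exact hmono (le_max_right n m) hm
        · exact hmono (le_max_left n m) (hn ψ hψ)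
    obtain ⟨n, hn⟩ := this
    exact (chain n).2.1 ⟨L, hn, hd⟩
  -- Maximality: a formula is rejected only if it would make `χ` derivable. All four properties of a
  -- saturated theory follow from this and from `hG`.
  have hmax (θ : Formula) : SetDerives T (insert θ G) χ ∨
      θ ∈ G ∧ ∀ φ, θ = ex φ → ∃ t, φ.inst t ∈ G := by
    obtain ⟨n, rfl⟩ := henum θ
    rcases (hnext (chain n) (enum n)).2.2 with hd | ⟨hθ, hw⟩
    · exact .inl (hd.mono (Set.insert_subset_insert (sub n)))
    · refine .inr ⟨sub (n + 1) hθ, fun φ hφ => ?_⟩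
      obtain ⟨t, ht⟩ := hw φ hφ
      exact ⟨t, sub (n + 1) ht⟩
  have hyp {θ : Formula} (hθ : θ ∈ G) : SetDerives T G θ :=
    ⟨[θ], by simpa using hθ, .hyp (by simp)⟩
  refine ⟨⟨G, ?_, ?_, ?_, ?_⟩, sub 0, fun hχ => hG (hyp hχ)⟩
  · intro θ hd
    rcases hmax θ with h | h
    · exact (hG (h.cut hd)).elim
    · exact h.1
  · intro hb
    exact hG ⟨[bot], by simpa using hb, .botE (.hyp (by simp))⟩
  · intro φ ψ hor
    rcases hmax φ with h₁ | h₁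
    · rcases hmax ψ with h₂ | h₂
      · obtain ⟨L₁, hL₁, hd₁⟩ := h₁.exists_of_insert
        obtain ⟨L₂, hL₂, hd₂⟩ := h₂.exists_of_insert
        refine (hG ⟨Formula.or φ ψ :: (L₁ ++ L₂), ?_, ?_⟩).elim
        · intro θ hθ
          simp only [List.mem_cons, List.mem_append] at hθ
          rcases hθ with rfl | hθ | hθ
          exacts [hor, hL₁ θ hθ, hL₂ θ hθ]
        · exact .orE .hyp₀ (hd₁.weaken (by intro θ; simp; tauto))
            (hd₂.weaken (by intro θ; simp; tauto))
      · exact .inr h₂.1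
    · exact .inl h₁.1
  · intro φ hex
    rcases hmax (ex φ) with h | h
    · exact (hG (h.cut (hyp hex))).elim
    · exact h.2 φ rfl

/-- A set that does not derive `χ` extends to a saturated theory without `χ`, after a renaming
that makes room for witnesses. -/
theorem exists_saturated {T A : Set Formula} {χ : Formula} (h : ¬ SetDerives T A χ) :
    ∃ G : Saturated T, (∀ θ ∈ A, θ.rename (2 * ·) ∈ G.carrier) ∧ χ.rename (2 * ·) ∉ G.carrier := by
  -- Doubling the variables leaves every odd one unused. Halving undoes it, so underivability is
  -- kept.
  have hd : ¬ SetDerives T ((·.rename (2 * ·)) '' A) (χ.rename (2 * ·)) := by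
    rintro ⟨L, hL, hd⟩
    have half (φ : Formula) : (φ.rename (2 * ·)).rename (· / 2) = φ := by
      rw [rename_rename]
      conv_rhs => rw [← rename_id φ]
      congr 1; funext i; simp
    have := hd.rename (· / 2)
    rw [half] at this
    refine h ⟨_, fun ψ hψ => ?_, this⟩
    obtain ⟨θ, hθ, rfl⟩ := List.mem_map.1 hψ
    obtain ⟨ψ, hψ, rfl⟩ := hL θ hθ
    rwa [half ψ]
  obtain ⟨G, hG, hχ⟩ := exists_saturated_of_extendable (T := T) ⟨hd, 0, by
    rintro t - ⟨k, rfl⟩ _ ⟨θ, -, rfl⟩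
    exact fresh_rename (fun i => by omega) θ⟩
  exact ⟨G, fun θ hθ => hG ⟨θ, hθ, rfl⟩, hχ⟩

/-! ### Kripke models -/

/-- A Kripke model over a category of worlds, with equality interpreted as identity. -/
structure KripkeModel where
  World : Type
  Hom : World → World → Type
  Dom : World → Type
  nonempty : ∀ w, Nonempty (Dom w)
  map : ∀ {w w' : World}, Hom w w' → Dom w → Dom w'
  id : ∀ w, Hom w w
  comp : ∀ {u v w : World}, Hom u v → Hom v w → Hom u w
  map_id : ∀ {w} (x : Dom w), map (id w) x = x
  map_comp : ∀ {u v w : World} (r : Hom u v) (s : Hom v w) (x : Dom u),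
    map (comp r s) x = map s (map r x)
  mem : ∀ {w : World}, Dom w → Dom w → Prop
  mem_map : ∀ {w w' : World} (r : Hom w w') {x y : Dom w}, mem x y → mem (map r x) (map r y)

/-- Kripke forcing. -/
def Forces (M : KripkeModel) : Formula → ∀ {w : M.World}, (ℕ → M.Dom w) → Prop
  | .mem x y, _, v => M.mem (v x) (v y)
  | .eq x y, _, v => v x = v y
  | .bot, _, _ => False
  | .and φ ψ, _, v => Forces M φ v ∧ Forces M ψ v
  | .or φ ψ, _, v => Forces M φ v ∨ Forces M ψ v
  | .imp φ ψ, w, v => ∀ ⦃w'⦄ (r : M.Hom w w'), Forces M φ (M.map r ∘ v) → Forces M ψ (M.map r ∘ v)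
  | .all φ, w, v => ∀ ⦃w'⦄ (r : M.Hom w w') (d : M.Dom w'), Forces M φ (scons d (M.map r ∘ v))
  | .ex φ, _, v => ∃ d, Forces M φ (scons d v)

/-! ### The canonical model -/

namespace Saturated

variable {T : Set Formula} (G : Saturated T)

theorem mem_of_derives {L : List Formula} {φ : Formula} (h : Derives T L φ)
    (hL : ∀ ψ ∈ L, ψ ∈ G.carrier) : φ ∈ G.carrier :=
  G.closed ⟨L, hL, h⟩

theorem subst {φ : Formula} {s t : ℕ} (h : eq s t ∈ G.carrier) (hs : φ.inst s ∈ G.carrier) :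
    φ.inst t ∈ G.carrier :=
  G.mem_of_derives (L := [eq s t, φ.inst s]) (.eqSubst .hyp₀ .hyp₁)
    (by simp [h, hs])

theorem eq_refl (t : ℕ) : eq t t ∈ G.carrier :=
  G.mem_of_derives (L := []) (.eqRefl t) (by simp)

theorem eq_symm {s t : ℕ} (h : eq s t ∈ G.carrier) : eq t s ∈ G.carrier :=
  G.subst (φ := eq 0 (s + 1)) h (G.eq_refl s)

/-- Variables that the theory identifies. -/
def setoid : Setoid ℕ where
  r s t := eq s t ∈ G.carrier
  iseqv :=
    { refl := G.eq_refl
      symm := G.eq_symm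
      trans := fun {s _ _} h h' => G.subst (φ := eq (s + 1) 0) h' h }

end Saturated

/-- The Kripke model of the saturated theories; its morphisms are renamings. -/
def canonicalModel (T : Set Formula) : KripkeModel where
  World := Saturated T
  Hom G H := {ρ : ℕ → ℕ // ∀ φ ∈ G.carrier, φ.rename ρ ∈ H.carrier}
  Dom G := Quotient G.setoid
  nonempty _ := ⟨Quotient.mk _ 0⟩
  map {G H} r := Quotient.map' (s₁ := G.setoid) (s₂ := H.setoid) r.1 fun s t h => r.2 (eq s t) h
  id _ := ⟨id, fun φ h => by rwa [rename_id]⟩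
  comp r s := ⟨s.1 ∘ r.1, fun φ h => by rw [← rename_rename]; exact s.2 _ (r.2 _ h)⟩
  map_id x := by induction x using Quotient.inductionOn; rfl
  map_comp r s x := by induction x using Quotient.inductionOn; rfl
  mem {G} := Quotient.lift₂ (fun x y => mem x y ∈ G.carrier) fun x y x' y' hx hy => propext
    ⟨fun h => G.subst (φ := mem (x' + 1) 0) hy (G.subst (φ := mem 0 (y + 1)) hx h),
     fun h => G.subst (φ := mem (x + 1) 0) (G.eq_symm hy)
      (G.subst (φ := mem 0 (y' + 1)) (G.eq_symm hx) h)⟩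
  mem_map {G _} r {x y} h := by
    induction x using Quotient.ind with | _ x
    induction y using Quotient.ind with | _ y
    exact r.2 (mem x y) h

theorem forces_scons {T : Set Formula} (φ : Formula) (G : Saturated T) (t : ℕ) (s : ℕ → ℕ) :
    Forces (canonicalModel T) φ (w := G) (Quotient.mk G.setoid ∘ scons t s) ↔
      Forces (canonicalModel T) φ (w := G)
        (scons (Quotient.mk G.setoid t) (Quotient.mk G.setoid ∘ s)) :=
  iff_of_eq (congrArg (Forces (canonicalModel T) φ (w := G)) (comp_scons _ _ _))

/-- The truth lemma. Only implication and universal quantification need further worlds, which are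
supplied by `exists_saturated`. -/
theorem forces_canonicalModel {T : Set Formula} (φ : Formula) {G : Saturated T} (s : ℕ → ℕ) :
    Forces (canonicalModel T) φ (w := G) (Quotient.mk G.setoid ∘ s) ↔ φ.rename s ∈ G.carrier := by
  induction φ generalizing G s with
  | mem x y => exact Iff.rfl
  | eq x y => exact Quotient.eq (r := G.setoid)
  | bot => exact iff_of_false id G.consistent
  | and φ ψ h₁ h₂ =>
    refine (and_congr (h₁ s) (h₂ s)).trans ⟨fun h => ?_, fun h => ⟨?_, ?_⟩⟩
    · exact G.mem_of_derives (L := [φ.rename s, ψ.rename s])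
        (.andI .hyp₀ .hyp₁) (by simp [h])
    · exact G.mem_of_derives (L := [_]) (.andE₁ .hyp₀) (by simpa [Formula.rename] using h)
    · exact G.mem_of_derives (L := [_]) (.andE₂ .hyp₀) (by simpa [Formula.rename] using h)
  | or φ ψ h₁ h₂ =>
    refine (or_congr (h₁ s) (h₂ s)).trans ⟨fun h => ?_, G.prime⟩
    rcases h with h | h
    · exact G.mem_of_derives (L := [φ.rename s]) (.orI₁ .hyp₀) (by simpa using h)
    · exact G.mem_of_derives (L := [ψ.rename s]) (.orI₂ .hyp₀) (by simpa using h)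
  | imp φ ψ h₁ h₂ =>
    constructor
    · intro h
      by_contra hn
      have hd : ¬ SetDerives T (insert (φ.rename s) G.carrier) (ψ.rename s) := fun hd => by
        obtain ⟨L, hL, hd⟩ := hd.exists_of_insert
        exact hn (G.mem_of_derives (.impI hd) hL)
      obtain ⟨H, hH, hψ⟩ := exists_saturated hd
      refine hψ ?_
      rw [rename_rename, ← h₂]
      refine h (w' := H) ⟨(2 * ·), fun θ hθ => hH θ (.inr hθ)⟩ ((h₁ (G := H) ((2 * ·) ∘ s)).2 ?_)
      rw [← rename_rename]
      exact hH _ (.inl rfl)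
    · intro h H r hφ
      have hφ' := (h₁ (G := H) (r.1 ∘ s)).1 hφ
      have h' := r.2 _ h
      refine (h₂ (G := H) (r.1 ∘ s)).2 (H.mem_of_derives
        (L := [imp (φ.rename (r.1 ∘ s)) (ψ.rename (r.1 ∘ s)), φ.rename (r.1 ∘ s)])
        (.impE .hyp₀ .hyp₁) ?_)
      simpa [hφ', Formula.rename, rename_rename] using h'
  | all φ ih =>
    constructor
    · intro h
      by_contra hn
      have hd : ¬ SetDerives T (shift '' G.carrier) (φ.rename (liftRen s)) := by
        rintro ⟨L, hL, hd⟩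
        have : ∃ L' : List Formula, L'.map shift = L ∧ ∀ ψ ∈ L', ψ ∈ G.carrier := by
          clear hd
          induction L with
          | nil => exact ⟨[], by simp⟩
          | cons θ L ihL =>
            obtain ⟨L', rfl, hL'⟩ := ihL fun ψ hψ => hL ψ (by simp [hψ])
            obtain ⟨θ', hθ', rfl⟩ := hL θ (by simp)
            exact ⟨θ' :: L', by simp, by simpa [hθ'] using hL'⟩
        obtain ⟨L', rfl, hL'⟩ := this
        exact hn (G.mem_of_derives (.allI hd) hL')
      obtain ⟨H, hH, hφ⟩ := exists_saturated hd
      refine hφ ?_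
      rw [rename_rename, ← ih, liftRen, comp_scons]
      -- The morphism is the shift followed by doubling. Variable `0`, freed by the shift and fixed
      -- by doubling, names the generic element.
      refine (forces_scons ..).2 (h (w' := H) ⟨fun i => 2 * (i + 1), fun θ hθ => ?_⟩ _)
      have := hH _ ⟨θ, hθ, rfl⟩
      rwa [shift, rename_rename] at this
    · intro h H r d
      induction d using Quotient.inductionOn with
      | _ t =>
      have := (ih (G := H) (scons t (r.1 ∘ s))).2 ?_
      · exact (forces_scons ..).1 this
      · have h' := r.2 _ h
        have := H.mem_of_derives (.allE t .hyp₀) (L := [_])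
          (by simpa [Formula.rename] using h')
        rwa [rename_liftRen_inst, rename_rename, scons_comp_liftRen] at this
  | ex φ ih =>
    constructor
    · rintro ⟨d, hd⟩
      induction d using Quotient.inductionOn with
      | _ t =>
      have := (ih (G := G) (scons t s)).1 ((forces_scons ..).2 hd)
      rw [← rename_liftRen_inst] at this
      exact G.mem_of_derives (L := [_]) (.exI t .hyp₀) (by simpa using this)
    · intro h
      obtain ⟨t, ht⟩ := G.witness h
      rw [rename_liftRen_inst, ← ih] at ht
      exact ⟨_, (forces_scons ..).1 ht⟩

/-- Completeness of intuitionistic natural deduction for Kripke models. -/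
theorem derives_of_forces {T : Set Formula} {φ : Formula}
    (h : ∀ M : KripkeModel, (∀ ψ ∈ T, ∀ {w} (v : ℕ → M.Dom w), Forces M ψ v) →
      ∀ {w} (v : ℕ → M.Dom w), Forces M φ v) : Derives T [] φ := by
  by_contra hn
  have hd : ¬ SetDerives T ∅ φ := by
    rintro ⟨L, hL, hd⟩
    obtain rfl : L = [] := List.eq_nil_iff_forall_not_mem.2 hL
    exact hn hd
  obtain ⟨G, -, hG⟩ := exists_saturated hd
  refine hG ((forces_canonicalModel φ _).1 (h (canonicalModel T) ?_ _))
  intro ψ hψ H v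
  obtain ⟨s, rfl⟩ : ∃ s : ℕ → ℕ, v = Quotient.mk H.setoid ∘ s :=
    ⟨fun i => (v i).out, funext fun i => (Quotient.out_eq _).symm⟩
  exact (forces_canonicalModel ψ s).2
    (H.mem_of_derives (.rename_of_forall (fun _ => .ax hψ) s []) (by simp))

/-! ### General facts on forcing -/

section Forcing

variable {M : KripkeModel} {w : M.World}

instance : Membership (M.Dom w) (M.Dom w) := ⟨fun y x => M.mem x y⟩

instance {w' : M.World} : CoeFun (M.Hom w w') fun _ => M.Dom w → M.Dom w' := ⟨M.map⟩

theorem mem_map {w' : M.World} (r : M.Hom w w') {x y : M.Dom w} (h : x ∈ y) : r x ∈ r y :=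
  M.mem_map r h

@[simp] theorem map_id (x : M.Dom w) : M.id w x = x := M.map_id x

theorem map_comp {u v : M.World} (r : M.Hom u v) (s : M.Hom v w) (x : M.Dom u) :
    M.comp r s x = s (r x) := M.map_comp r s x

theorem map_id_comp (v : ℕ → M.Dom w) : M.map (M.id w) ∘ v = v := by
  funext i; simp

theorem map_map_comp {u u' : M.World} (r : M.Hom u u') (s : M.Hom u' w) (v : ℕ → M.Dom u) :
    M.map s ∘ M.map r ∘ v = M.map (M.comp r s) ∘ v := by
  funext i; simp [map_comp]

@[simp] theorem scons_zero {α : Type} (a : α) (v : ℕ → α) : scons a v 0 = a := rfl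

@[simp] theorem scons_succ {α : Type} (a : α) (v : ℕ → α) (i : ℕ) : scons a v (i + 1) = v i := rfl

@[simp] theorem forces_mem (x y : ℕ) (v : ℕ → M.Dom w) : Forces M (mem x y) v ↔ v x ∈ v y := Iff.rfl

@[simp] theorem forces_eq (x y : ℕ) (v : ℕ → M.Dom w) : Forces M (eq x y) v ↔ v x = v y := Iff.rfl

@[simp] theorem forces_bot (v : ℕ → M.Dom w) : Forces M bot v ↔ False := Iff.rfl

@[simp] theorem forces_and (φ ψ : Formula) (v : ℕ → M.Dom w) :
    Forces M (.and φ ψ) v ↔ Forces M φ v ∧ Forces M ψ v := Iff.rfl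

@[simp] theorem forces_or (φ ψ : Formula) (v : ℕ → M.Dom w) :
    Forces M (.or φ ψ) v ↔ Forces M φ v ∨ Forces M ψ v := Iff.rfl

@[simp] theorem forces_ex (φ : Formula) (v : ℕ → M.Dom w) :
    Forces M (ex φ) v ↔ ∃ d, Forces M φ (scons d v) := Iff.rfl

theorem forces_imp (φ ψ : Formula) (v : ℕ → M.Dom w) : Forces M (imp φ ψ) v ↔
    ∀ ⦃w' : M.World⦄ (r : M.Hom w w'), Forces M φ (M.map r ∘ v) → Forces M ψ (M.map r ∘ v) :=
  Iff.rfl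

theorem forces_all (φ : Formula) (v : ℕ → M.Dom w) : Forces M (all φ) v ↔
    ∀ ⦃w' : M.World⦄ (r : M.Hom w w') d, Forces M φ (scons d (M.map r ∘ v)) := Iff.rfl

theorem forces_neg (φ : Formula) (v : ℕ → M.Dom w) : Forces M (neg φ) v ↔
    ∀ ⦃w' : M.World⦄ (r : M.Hom w w'), ¬ Forces M φ (M.map r ∘ v) := Iff.rfl

theorem Forces.map {φ : Formula} {v : ℕ → M.Dom w} (h : Forces M φ v) {w' : M.World}
    (r : M.Hom w w') : Forces M φ (M.map r ∘ v) := by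
  induction φ generalizing w w' with
  | mem x y => exact mem_map r h
  | eq x y => exact congrArg r h
  | bot => exact h
  | and φ ψ h₁ h₂ => exact ⟨h₁ h.1 r, h₂ h.2 r⟩
  | or φ ψ h₁ h₂ => exact h.imp (fun h => h₁ h r) fun h => h₂ h r
  | imp φ ψ =>
    intro w'' s hφ
    rw [map_map_comp] at hφ ⊢
    exact h _ hφ
  | all φ =>
    intro w'' s d
    rw [map_map_comp]
    exact h _ d
  | ex φ ih =>
    obtain ⟨d, hd⟩ := h
    exact ⟨r d, by simpa [comp_scons] using ih hd r⟩

theorem forces_rename (φ : Formula) (ρ : ℕ → ℕ) (v : ℕ → M.Dom w) :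
    Forces M (φ.rename ρ) v ↔ Forces M φ (v ∘ ρ) := by
  induction φ generalizing w ρ with
  | mem x y | eq x y | bot => exact Iff.rfl
  | and φ ψ h₁ h₂ => exact and_congr (h₁ ρ v) (h₂ ρ v)
  | or φ ψ h₁ h₂ => exact or_congr (h₁ ρ v) (h₂ ρ v)
  | imp φ ψ h₁ h₂ =>
    exact forall₂_congr fun w' r => imp_congr (h₁ ρ (M.map r ∘ v)) (h₂ ρ (M.map r ∘ v))
  | all φ ih =>
    refine forall₃_congr fun w' r d => ?_
    rw [ih, scons_comp_liftRen]
    exact Iff.rfl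
  | ex φ ih => exact exists_congr fun d => by rw [ih, scons_comp_liftRen]

/-- A quantifier followed by an implication passes to a later world twice; composition of morphisms
reduces this to one passage. -/
theorem forces_all_imp (φ ψ : Formula) (v : ℕ → M.Dom w) : Forces M (all (imp φ ψ)) v ↔
    ∀ ⦃w' : M.World⦄ (r : M.Hom w w') d,
      Forces M φ (scons d (M.map r ∘ v)) → Forces M ψ (scons d (M.map r ∘ v)) := by
  refine ⟨fun h w' r d => ?_, fun h w' r d w'' s => ?_⟩
  · simpa only [map_id_comp] using h r d (M.id _)
  · rw [comp_scons, map_map_comp]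
    exact h _ _

theorem forces_all_iff (φ ψ : Formula) (v : ℕ → M.Dom w) : Forces M (all (iff φ ψ)) v ↔
    ∀ ⦃w' : M.World⦄ (r : M.Hom w w') d,
      (Forces M φ (scons d (M.map r ∘ v)) ↔ Forces M ψ (scons d (M.map r ∘ v))) := by
  have : Forces M (all (iff φ ψ)) v ↔ Forces M (all (imp φ ψ)) v ∧ Forces M (all (imp ψ φ)) v :=
    ⟨fun h => ⟨fun _ r d => (h r d).1, fun _ r d => (h r d).2⟩, fun h _ r d => ⟨h.1 r d, h.2 r d⟩⟩
  simp only [this, forces_all_imp, ← forall_and, iff_iff_implies_and_implies]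

theorem forces_all_all_imp (φ ψ : Formula) (v : ℕ → M.Dom w) :
    Forces M (all (all (imp φ ψ))) v ↔ ∀ ⦃w' : M.World⦄ (r : M.Hom w w') d e,
      Forces M φ (scons e (scons d (M.map r ∘ v))) →
        Forces M ψ (scons e (scons d (M.map r ∘ v))) := by
  simp only [forces_all (all _), forces_all_imp]
  refine ⟨fun h w' r d e => ?_, fun h w' r d w'' s e => ?_⟩
  · simpa only [map_id_comp] using h r d (M.id _) e
  · rw [comp_scons, map_map_comp]
    exact h _ _ _

theorem forces_all_all_all_imp (φ ψ : Formula) (v : ℕ → M.Dom w) :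
    Forces M (all (all (all (imp φ ψ)))) v ↔ ∀ ⦃w' : M.World⦄ (r : M.Hom w w') d e f,
      Forces M φ (scons f (scons e (scons d (M.map r ∘ v)))) →
        Forces M ψ (scons f (scons e (scons d (M.map r ∘ v)))) := by
  simp only [forces_all (all (all _)), forces_all_all_imp]
  refine ⟨fun h w' r d e f => ?_, fun h w' r d w'' s e f => ?_⟩
  · simpa only [map_id_comp] using h r d (M.id _) e f
  · rw [comp_scons, map_map_comp]
    exact h _ _ _ _

/-- `x` and `y` are not equal, in the sense of intuitionistic negation. -/
def Apart (x y : M.Dom w) : Prop := ∀ ⦃w'⦄ (r : M.Hom w w'), r x ≠ r y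

theorem Apart.map {x y : M.Dom w} (h : Apart x y) (r : M.Hom w w') : Apart (r x) (r y) :=
  fun w'' s => by simpa only [← map_comp] using h (M.comp r s)

theorem Apart.symm {x y : M.Dom w} (h : Apart x y) : Apart y x := fun _ r => (h r).symm

theorem Apart.ne {x y : M.Dom w} (h : Apart x y) : x ≠ y := by simpa using h (M.id w)

@[simp] theorem forces_neg_eq (x y : ℕ) (v : ℕ → M.Dom w) :
    Forces M (neg (eq x y)) v ↔ Apart (v x) (v y) := by
  simp [forces_neg, Apart]

/-- Equality is decidable on `u`. -/
def DecEq (u : M.Dom w) : Prop :=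
  ∀ ⦃w'⦄ (r : M.Hom w w') (x y : M.Dom w'), x ∈ r u → y ∈ r u → x = y ∨ Apart x y

theorem DecEq.map {u : M.Dom w} (hD : DecEq u) (r : M.Hom w w') : DecEq (r u) :=
  fun w'' s => by simpa only [← map_comp] using hD (M.comp r s)

theorem apart_of_mem {u c x : M.Dom w} (hc : ∀ ⦃w'⦄ (s : M.Hom w w'), s c ∉ s u) (hx : x ∈ u) :
    Apart x c :=
  fun _ s h => hc s (h ▸ mem_map s hx)

end Forcing

/-! ### Models of INF -/

theorem Formula.Stratified.intro {φ : Formula} (σ : ℕ → ℕ) (h : φ.StratWith σ) : φ.Stratified :=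
  ⟨σ, h⟩

/-- A Kripke model of INF. -/
class IsModel (M : KripkeModel) : Prop where
  forces : ∀ ψ ∈ theory, ∀ {w} (v : ℕ → M.Dom w), Forces M ψ v

section Models

variable {M : KripkeModel} [IsModel M] {w w' : M.World}

theorem ext {a b : M.Dom w}
    (h : ∀ ⦃w' : M.World⦄ (r : M.Hom w w') x, x ∈ r a ↔ x ∈ r b) : a = b := by
  have h₀ := IsModel.forces extensionality (.inl rfl) (fun _ => a : ℕ → M.Dom w)
  rw [extensionality, forces_all_all_imp] at h₀
  simpa using h₀ (M.id w) a b (by simpa [forces_all_iff] using h)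

theorem exists_compr (φ : Formula) (hφ : φ.Stratified) (v : ℕ → M.Dom w) :
    ∃ y : M.Dom w, ∀ ⦃w' : M.World⦄ (r : M.Hom w w') x,
      x ∈ r y ↔ Forces M φ (scons x (M.map r ∘ v)) := by
  obtain ⟨y, hy⟩ := IsModel.forces (comprehension φ) (.inr ⟨φ, hφ, rfl⟩) v
  refine ⟨y, fun w' r x => ?_⟩
  have := (forces_all_iff _ _ _).1 hy r x
  rw [forces_rename, scons_comp_liftRen] at this
  exact this

/-- The set `{x | φ}`. -/
noncomputable def compr (φ : Formula) (hφ : φ.Stratified) (v : ℕ → M.Dom w) : M.Dom w :=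
  (exists_compr φ hφ v).choose

theorem mem_map_compr (φ : Formula) (hφ : φ.Stratified) (v : ℕ → M.Dom w) (r : M.Hom w w')
    (x : M.Dom w') : x ∈ r (compr φ hφ v) ↔ Forces M φ (scons x (M.map r ∘ v)) :=
  (exists_compr φ hφ v).choose_spec r x

theorem mem_compr (φ : Formula) (hφ : φ.Stratified) (v : ℕ → M.Dom w)
    (x : M.Dom w) : x ∈ compr φ hφ v ↔ Forces M φ (scons x v) := by
  simpa [map_id_comp] using mem_map_compr φ hφ v (M.id w) x

/-- An arbitrary element, assigned to variables that do not occur. -/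
noncomputable def default (w : M.World) : M.Dom w := (M.nonempty w).some

/-! #### Unordered and ordered pairs -/

/-- `{a, b}` -/
noncomputable def upair (a b : M.Dom w) : M.Dom w :=
  compr (.or (eq 0 1) (eq 0 2)) (.intro (fun _ => 0) (by simp [StratWith])) (scons a fun _ => b)

theorem mem_map_upair {a b : M.Dom w} {r : M.Hom w w'} {x : M.Dom w'} :
    x ∈ r (upair a b) ↔ x = r a ∨ x = r b := by
  rw [upair, mem_map_compr]
  simp

@[simp] theorem mem_upair {a b x : M.Dom w} : x ∈ upair a b ↔ x = a ∨ x = b := by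
  simp [upair, mem_compr]

@[simp] theorem map_upair (r : M.Hom w w') (a b : M.Dom w) : r (upair a b) = upair (r a) (r b) :=
  ext fun w'' s x => by simp [← map_comp, mem_map_upair]

-- Extensionality turns a defining formula into an equation with a term. With such equations for all
-- the basic notions, `simp` evaluates forcing in terms of elements of worlds.
@[simp] theorem forces_isUPair (s a b : ℕ) (v : ℕ → M.Dom w) :
    Forces M (isUPair s a b) v ↔ v s = upair (v a) (v b) := by
  rw [isUPair, forces_all_iff]
  exact ⟨fun h => ext fun w' r x => by simpa using h r x, fun h => by simp [h]⟩

/-- `⟨x, y⟩` -/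
noncomputable def pair (x y : M.Dom w) : M.Dom w := upair (upair x x) (upair x y)

@[simp] theorem map_pair (r : M.Hom w w') (a b : M.Dom w) : r (pair a b) = pair (r a) (r b) := by
  simp [pair]

@[simp] theorem forces_isOPair (p x y : ℕ) (v : ℕ → M.Dom w) :
    Forces M (isOPair p x y) v ↔ v p = pair (v x) (v y) := by
  simp [isOPair, pair]

theorem eq_of_upair_eq_upair {a b c : M.Dom w} (h : upair a a = upair b c) : a = b ∧ a = c := by
  have hb : b ∈ upair a a := by simp [h]
  have hc : c ∈ upair a a := by simp [h]
  simp only [mem_upair, or_self] at hb hc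
  exact ⟨hb.symm, hc.symm⟩

@[simp] theorem pair_inj {a b c d : M.Dom w} : pair a b = pair c d ↔ a = c ∧ b = d := by
  refine ⟨fun h => ?_, by rintro ⟨rfl, rfl⟩; rfl⟩
  have h₁ : upair a a ∈ pair c d := h ▸ (by simp [pair] : upair a a ∈ pair a b)
  have hac : a = c := by
    rcases mem_upair.1 h₁ with h₁ | h₁ <;> exact (eq_of_upair_eq_upair h₁).1
  subst hac
  refine ⟨rfl, ?_⟩
  have h₂ : upair a b ∈ pair a d := h ▸ (by simp [pair] : upair a b ∈ pair a b)
  have h₃ : upair a d ∈ pair a b := h ▸ (by simp [pair] : upair a d ∈ pair a d)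
  have collapse {x y z : M.Dom w} (h : upair x y = upair x z) : y = x ∨ y = z := by
    rw [← mem_upair, ← h]; simp
  rcases mem_upair.1 h₂ with h₂ | h₂
  · obtain ⟨-, rfl⟩ := eq_of_upair_eq_upair h₂.symm
    rcases mem_upair.1 h₃ with h₃ | h₃ <;> exact (eq_of_upair_eq_upair h₃.symm).2
  · rcases collapse h₂ with rfl | h₄
    · exact (eq_of_upair_eq_upair h₂).2
    · exact h₄

@[simp] theorem forces_pairMem (x y f : ℕ) (v : ℕ → M.Dom w) :
    Forces M (pairMem x y f) v ↔ pair (v x) (v y) ∈ v f := by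
  simp [pairMem]

/-! #### Functions -/

/-- `f ∈ FUNC` -/
def IsFunc (f : M.Dom w) : Prop :=
  ∀ ⦃w'⦄ (r : M.Hom w w') (x y z : M.Dom w'), pair x y ∈ r f → pair x z ∈ r f → y = z

@[simp] theorem forces_isFunc (f : ℕ) (v : ℕ → M.Dom w) :
    Forces M (isFunc f) v ↔ IsFunc (v f) := by
  rw [isFunc, forces_all_all_all_imp]
  simp only [forces_imp]
  refine ⟨fun h w' r x y z hy hz => ?_, fun h w' r x y z hy w'' s hz => ?_⟩
  · simpa using h r x y z (by simpa using hy) (M.id _) (by simpa using hz)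
  · have := (Forces.map hy s)
    simp only [forces_pairMem, Function.comp_apply, scons_succ, scons_zero, ← map_comp] at this hz
    exact h _ _ _ _ this hz

theorem IsFunc.map {f : M.Dom w} (h : IsFunc f) (r : M.Hom w w') : IsFunc (r f) :=
  fun w'' s x y z => by simpa only [← map_comp] using h (M.comp r s) x y z

theorem IsFunc.eq {f x y z : M.Dom w} (h : IsFunc f) (hy : pair x y ∈ f) (hz : pair x z ∈ f) :
    y = z := by
  simpa using h (M.id w) x y z (by simpa using hy) (by simpa using hz)

/-- `v = Ap(f, x)` -/
def IsAp (v f x : M.Dom w) : Prop :=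
  ∀ ⦃w'⦄ (r : M.Hom w w') (u : M.Dom w'), u ∈ r v ↔ ∃ y, pair (r x) y ∈ r f ∧ u ∈ y

@[simp] theorem forces_isAp (a f x : ℕ) (v : ℕ → M.Dom w) :
    Forces M (isAp a f x) v ↔ IsAp (v a) (v f) (v x) := by
  simp [isAp, forces_all_iff, IsAp]

theorem IsFunc.isAp_iff {f x y v : M.Dom w} (h : IsFunc f) (hy : pair x y ∈ f) :
    IsAp v f x ↔ v = y := by
  have key {w'} (r : M.Hom w w') (u : M.Dom w') :
      (∃ z, pair (r x) z ∈ r f ∧ u ∈ z) ↔ u ∈ r y := by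
    have hy' := mem_map r hy
    rw [map_pair] at hy'
    refine ⟨fun ⟨z, hz, hu⟩ => ?_, fun hu => ⟨_, hy', hu⟩⟩
    rwa [(h.map r).eq hy' hz]
  simp only [IsAp, key]
  exact ⟨fun h => ext h, by rintro rfl; simp⟩

/-! #### Stratification of the basic notions -/

-- A pair lies two levels above its components, hence a function three levels above its arguments.
-- With arguments at `k`, Church numbers are at `k + 6` and their successor function at `k + 9`.
@[simp] theorem stratWith_isOPair (p x y : ℕ) (σ : ℕ → ℕ) :
    (isOPair p x y).StratWith σ ↔ σ y = σ x ∧ σ p = σ x + 2 := by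
  simp only [isOPair, isUPair, StratWith, Formula.iff, scons_zero, scons_succ]
  constructor
  · rintro ⟨k, l, ⟨_, h₁⟩, ⟨_, h₂⟩, ⟨_, h₃⟩⟩
    omega
  · rintro ⟨h₁, h₂⟩
    refine ⟨σ x + 1, σ x + 1, ⟨σ x, ?_⟩, ⟨σ x, ?_⟩, ⟨σ x + 1, ?_⟩⟩ <;> simp <;> omega

@[simp] theorem stratWith_pairMem (x y f : ℕ) (σ : ℕ → ℕ) :
    (pairMem x y f).StratWith σ ↔ σ y = σ x ∧ σ f = σ x + 3 := by
  simp only [pairMem, StratWith, stratWith_isOPair, scons_zero, scons_succ]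
  constructor
  · rintro ⟨k, h⟩; omega
  · intro h; exact ⟨σ x + 2, by omega⟩

@[simp] theorem stratWith_isFunc (f : ℕ) (σ : ℕ → ℕ) :
    (isFunc f).StratWith σ ↔ ∃ k, σ f = k + 3 := by
  simp only [isFunc, StratWith, stratWith_pairMem, scons]
  constructor
  · rintro ⟨k, _, _, h⟩; exact ⟨k, by omega⟩
  · rintro ⟨k, h⟩; exact ⟨k, k, k, by omega⟩

@[simp] theorem stratWith_iff (φ ψ : Formula) (σ : ℕ → ℕ) :
    (iff φ ψ).StratWith σ ↔ φ.StratWith σ ∧ ψ.StratWith σ := by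
  simp only [Formula.iff, StratWith]; tauto

theorem stratWith_isAp {v f x k : ℕ} {σ : ℕ → ℕ} (hv : σ v = k + 1) (hx : σ x = k + 1)
    (hf : σ f = k + 4) : (isAp v f x).StratWith σ :=
  ⟨k, by simp [StratWith, hv, hx, hf]⟩

/-! #### The empty set and adjunction of an element -/

/-- `∅` -/
noncomputable def empty (w : M.World) : M.Dom w :=
  compr bot (.intro (fun _ => 0) (by simp [StratWith])) fun _ => default w

theorem not_mem_map_empty {r : M.Hom w w'} {x : M.Dom w'} : x ∉ r (empty w) := by
  rw [empty, mem_map_compr]; simp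

@[simp] theorem not_mem_empty {x : M.Dom w} : x ∉ empty w := by
  rw [empty, mem_compr]; simp

@[simp] theorem map_empty (r : M.Hom w w') : r (empty w) = empty w' :=
  ext fun w'' s x => by simp [← map_comp, not_mem_map_empty]

@[simp] theorem forces_isEmpty (e : ℕ) (v : ℕ → M.Dom w) :
    Forces M (isEmpty e) v ↔ v e = empty w := by
  rw [isEmpty, neg, forces_all_imp]
  exact ⟨fun h => ext fun w' r x => by simpa using h r x, fun h => by simp [h]⟩

/-- `u ∪ {c}` -/
noncomputable def adjoin (u c : M.Dom w) : M.Dom w :=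
  compr (.or (mem 0 1) (eq 0 2)) (.intro (scons 0 (scons 1 fun _ => 0)) (by simp [StratWith]))
    (scons u fun _ => c)

theorem mem_map_adjoin {u c : M.Dom w} {r : M.Hom w w'} {x : M.Dom w'} :
    x ∈ r (adjoin u c) ↔ x ∈ r u ∨ x = r c := by
  rw [adjoin, mem_map_compr]; simp

@[simp] theorem mem_adjoin {u c x : M.Dom w} : x ∈ adjoin u c ↔ x ∈ u ∨ x = c := by
  rw [adjoin, mem_compr]; simp

@[simp] theorem map_adjoin (r : M.Hom w w') (u c : M.Dom w) :
    r (adjoin u c) = adjoin (r u) (r c) :=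
  ext fun w'' s x => by simp [← map_comp, mem_map_adjoin]

@[simp] theorem forces_isAdjoin (a u c : ℕ) (v : ℕ → M.Dom w) :
    Forces M (isAdjoin a u c) v ↔ v a = adjoin (v u) (v c) := by
  rw [isAdjoin, forces_all_iff]
  exact ⟨fun h => ext fun w' r x => by simpa using h r x, fun h => by simp [h]⟩

/-! #### Church zero -/

theorem stratWith_isId {i k : ℕ} {σ : ℕ → ℕ} (h : σ i = k + 3) : (isId i).StratWith σ :=
  ⟨k + 2, by simp [StratWith, h]⟩

/-- The identity function. -/
noncomputable def idFun (w : M.World) : M.Dom w :=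
  compr (ex (isOPair 1 0 0)) (.intro (fun _ => 2) ⟨0, by simp⟩) fun _ => default w

theorem mem_map_idFun {r : M.Hom w w'} {p : M.Dom w'} :
    p ∈ r (idFun w) ↔ ∃ x, p = pair x x := by
  rw [idFun, mem_map_compr]; simp

theorem mem_idFun {p : M.Dom w} : p ∈ idFun w ↔ ∃ x, p = pair x x := by
  rw [idFun, mem_compr]; simp

@[simp] theorem map_idFun (r : M.Hom w w') : r (idFun w) = idFun w' :=
  ext fun w'' s x => by simp only [← map_comp, mem_map_idFun]

@[simp] theorem pair_mem_idFun {x y : M.Dom w} : pair x y ∈ idFun w ↔ x = y := by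
  simp [mem_idFun, eq_comm]

@[simp] theorem forces_isId (i : ℕ) (v : ℕ → M.Dom w) :
    Forces M (isId i) v ↔ v i = idFun w := by
  rw [isId, forces_all_iff]
  exact ⟨fun h => ext fun w' r x => by simpa [mem_idFun] using h r x, fun h => by
    simp [h, mem_idFun]⟩

theorem isFunc_idFun : IsFunc (idFun w) := by
  intro w' r x y z hy hz
  simp only [map_idFun, pair_mem_idFun] at hy hz
  exact hy.symm.trans hz

theorem stratWith_isZero {o k : ℕ} {σ : ℕ → ℕ} (h : σ o = k + 6) : (isZero o).StratWith σ :=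
  ⟨k + 5, (stratWith_iff _ _ _).2
    ⟨h, k + 3, k + 3, stratWith_isId (k := k) rfl, by simp⟩⟩

/-- Church zero. -/
noncomputable def zero (w : M.World) : M.Dom w :=
  compr (ex (ex (.and (isId 0) (isOPair 2 1 0))))
    (.intro (fun _ => 5) ⟨3, 3, stratWith_isId (k := 0) rfl, by simp⟩) fun _ => default w

theorem mem_map_zero {r : M.Hom w w'} {p : M.Dom w'} :
    p ∈ r (zero w) ↔ ∃ f, p = pair f (idFun w') := by
  rw [zero, mem_map_compr]; simp

theorem mem_zero {p : M.Dom w} : p ∈ zero w ↔ ∃ f, p = pair f (idFun w) := by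
  rw [zero, mem_compr]; simp

@[simp] theorem map_zero (r : M.Hom w w') : r (zero w) = zero w' :=
  ext fun w'' s x => by simp only [← map_comp, mem_map_zero]

@[simp] theorem pair_mem_zero {f t : M.Dom w} : pair f t ∈ zero w ↔ t = idFun w := by
  simp [mem_zero]

@[simp] theorem forces_isZero (o : ℕ) (v : ℕ → M.Dom w) :
    Forces M (isZero o) v ↔ v o = zero w := by
  rw [isZero, forces_all_iff]
  exact ⟨fun h => ext fun w' r x => by simpa [mem_zero] using h r x, fun h => by
    simp [h, mem_zero]⟩

theorem isFunc_zero : IsFunc (zero w) := by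
  intro w' r x y z hy hz
  simp only [map_zero, pair_mem_zero] at hy hz
  exact hy.trans hz.symm

/-! #### Church successor -/

theorem stratWith_isSuccMap {p z f k : ℕ} {σ : ℕ → ℕ} (hp : σ p = k + 3) (hf : σ f = k + 3)
    (hz : σ z = k + 6) : (isSuccMap p z f).StratWith σ :=
  ⟨k + 2, by simp [StratWith, hp, hf, hz]⟩

/-- The function taking `x` to `f (z f x)`. -/
noncomputable def succMap (z f : M.Dom w) : M.Dom w :=
  compr (ex (ex (ex (ex (.and (isOPair 4 3 2) (.and (isFunc 1)
      (.and (pairMem 6 1 5) (.and (pairMem 3 0 1) (pairMem 0 2 6)))))))))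
    (.intro (scons 2 (scons 6 fun _ => 3)) ⟨0, 0, 3, 0, by simp [StratWith]⟩) (scons z fun _ => f)

theorem mem_map_succMap {z f : M.Dom w} {r : M.Hom w w'} {p : M.Dom w'} :
    p ∈ r (succMap z f) ↔ ∃ x y t q, p = pair x y ∧ IsFunc t ∧ pair (r f) t ∈ r z ∧
      pair x q ∈ t ∧ pair q y ∈ r f := by
  rw [succMap, mem_map_compr]; simp

theorem mem_succMap {z f p : M.Dom w} :
    p ∈ succMap z f ↔ ∃ x y t q, p = pair x y ∧ IsFunc t ∧ pair f t ∈ z ∧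
      pair x q ∈ t ∧ pair q y ∈ f := by
  rw [succMap, mem_compr]; simp

@[simp] theorem map_succMap (r : M.Hom w w') (z f : M.Dom w) :
    r (succMap z f) = succMap (r z) (r f) :=
  ext fun w'' s x => by simp only [← map_comp, mem_map_succMap]

theorem pair_mem_succMap {z f x y : M.Dom w} : pair x y ∈ succMap z f ↔
    ∃ t q, IsFunc t ∧ pair f t ∈ z ∧ pair x q ∈ t ∧ pair q y ∈ f := by
  simp [mem_succMap]

@[simp] theorem forces_isSuccMap (p z f : ℕ) (v : ℕ → M.Dom w) :
    Forces M (isSuccMap p z f) v ↔ v p = succMap (v z) (v f) := by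
  rw [isSuccMap, forces_all_iff]
  exact ⟨fun h => ext fun w' r x => by simpa [mem_succMap] using h r x, fun h => by
    simp [h, mem_succMap]⟩

theorem IsFunc.succMap {z f : M.Dom w} (hz : IsFunc z) (hf : IsFunc f) : IsFunc (succMap z f) := by
  intro w' r x y y' hy hy'
  rw [map_succMap, pair_mem_succMap] at hy hy'
  obtain ⟨t, q, ht, hzt, hq, hqy⟩ := hy
  obtain ⟨t', q', -, hzt', hq', hqy'⟩ := hy'
  obtain rfl := (hz.map r).eq hzt hzt'
  obtain rfl := ht.eq hq hq'
  exact (hf.map r).eq hqy hqy'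

theorem stratWith_isSuccValue {s z k : ℕ} {σ : ℕ → ℕ} (hs : σ s = k + 6) (hz : σ z = k + 6) :
    (isSuccValue s z).StratWith σ :=
  ⟨k + 5, (stratWith_iff _ _ _).2 ⟨hs, k + 3, k + 3, by simp, (stratWith_isFunc _ _).2 ⟨k, rfl⟩,
    stratWith_isSuccMap (k := k) rfl rfl hz⟩⟩

/-- The Church successor of `z`. -/
noncomputable def succVal (z : M.Dom w) : M.Dom w :=
  compr (ex (ex (.and (isOPair 2 1 0) (.and (isFunc 1) (isSuccMap 0 3 1)))))
    (.intro (scons 5 fun _ => 6) ⟨3, 3, by simp,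
      ⟨(stratWith_isFunc _ _).2 ⟨0, rfl⟩, stratWith_isSuccMap (k := 0) rfl rfl rfl⟩⟩) fun _ => z

theorem mem_map_succVal {z : M.Dom w} {r : M.Hom w w'} {p : M.Dom w'} :
    p ∈ r (succVal z) ↔ ∃ f, p = pair f (succMap (r z) f) ∧ IsFunc f := by
  rw [succVal, mem_map_compr]; simp [and_comm]

theorem mem_succVal {z p : M.Dom w} :
    p ∈ succVal z ↔ ∃ f, p = pair f (succMap z f) ∧ IsFunc f := by
  rw [succVal, mem_compr]; simp [and_comm]

@[simp] theorem map_succVal (r : M.Hom w w') (z : M.Dom w) : r (succVal z) = succVal (r z) :=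
  ext fun w'' s x => by simp only [← map_comp, mem_map_succVal]

theorem pair_mem_succVal {z f t : M.Dom w} :
    pair f t ∈ succVal z ↔ IsFunc f ∧ t = succMap z f := by
  simp [mem_succVal, and_comm]

@[simp] theorem forces_isSuccValue (s z : ℕ) (v : ℕ → M.Dom w) :
    Forces M (isSuccValue s z) v ↔ v s = succVal (v z) := by
  rw [isSuccValue, forces_all_iff]
  exact ⟨fun h => ext fun w' r x => by simpa [mem_succVal, and_comm] using h r x,
    fun h => by simp [h, mem_succVal, and_comm]⟩

theorem isFunc_succVal (z : M.Dom w) : IsFunc (succVal z) := by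
  intro w' r x y y' hy hy'
  rw [map_succVal, pair_mem_succVal] at hy hy'
  exact hy.2.trans hy'.2.symm

theorem stratWith_isSucc {S k : ℕ} {σ : ℕ → ℕ} (hS : σ S = k + 9) : (isSucc S).StratWith σ :=
  ⟨k + 8, (stratWith_iff _ _ _).2 ⟨hS, k + 6, k + 6, by simp,
    (stratWith_isFunc _ _).2 ⟨k + 3, rfl⟩, stratWith_isSuccValue (k := k) rfl rfl⟩⟩

/-- Church successor. -/
noncomputable def succ (w : M.World) : M.Dom w :=
  compr (ex (ex (.and (isOPair 2 1 0) (.and (isFunc 1) (isSuccValue 0 1)))))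
    (.intro (fun _ => 8) ⟨6, 6, by simp,
      ⟨(stratWith_isFunc _ _).2 ⟨3, rfl⟩, stratWith_isSuccValue (k := 0) rfl rfl⟩⟩)
    fun _ => default w

theorem mem_map_succ {r : M.Hom w w'} {p : M.Dom w'} :
    p ∈ r (succ w) ↔ ∃ z, p = pair z (succVal z) ∧ IsFunc z := by
  rw [succ, mem_map_compr]; simp [and_comm]

theorem mem_succ {p : M.Dom w} :
    p ∈ succ w ↔ ∃ z, p = pair z (succVal z) ∧ IsFunc z := by
  rw [succ, mem_compr]; simp [and_comm]

@[simp] theorem map_succ (r : M.Hom w w') : r (succ w) = succ w' :=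
  ext fun w'' s x => by simp only [← map_comp, mem_map_succ]

theorem pair_mem_succ {z s : M.Dom w} : pair z s ∈ succ w ↔ IsFunc z ∧ s = succVal z := by
  simp [mem_succ, and_comm]

@[simp] theorem forces_isSucc (s : ℕ) (v : ℕ → M.Dom w) :
    Forces M (isSucc s) v ↔ v s = succ w := by
  rw [isSucc, forces_all_iff]
  exact ⟨fun h => ext fun w' r x => by simpa [mem_succ, and_comm] using h r x,
    fun h => by simp [h, mem_succ, and_comm]⟩

theorem isFunc_succ : IsFunc (succ w) := by
  intro w' r x y z hy hz
  rw [map_succ, pair_mem_succ] at hy hz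
  exact hy.2.trans hz.2.symm

/-! #### The set of Church numbers -/

/-- `X` contains Church zero and is closed under Church successor. -/
def Inductive (X : M.Dom w) : Prop :=
  zero w ∈ X ∧ ∀ ⦃w'⦄ (r : M.Hom w w') (u : M.Dom w'), u ∈ r X →
    ∃ v, IsAp v (succ w') u ∧ v ∈ r X

theorem forces_isInductive (X o S : ℕ) (v : ℕ → M.Dom w) (ho : v o = zero w) (hS : v S = succ w) :
    Forces M (isInductive X o S) v ↔ Inductive (v X) := by
  simp [isInductive, Inductive, forces_all_imp, ho, hS]

/-- `x` belongs to all inductive sets. -/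
def ChurchNumber (x : M.Dom w) : Prop :=
  ∀ ⦃w'⦄ (r : M.Hom w w') (X : M.Dom w'), Inductive X → r x ∈ X

theorem forces_isChurchNumber (x : ℕ) (v : ℕ → M.Dom w) :
    Forces M (isChurchNumber x) v ↔ ChurchNumber (v x) := by
  have (v : ℕ → M.Dom w) : Forces M (all (imp (isInductive 0 2 1) (mem (x + 3) 0)))
      (scons (succ w) (scons (zero w) v)) ↔ ChurchNumber (v x) := by
    rw [forces_all_imp]
    refine forall₃_congr fun w' r X => ?_
    rw [forces_isInductive _ _ _ _ (by simp) (by simp)]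
    simp
  simp [isChurchNumber, this]

theorem stratified_isChurchNumber : (isChurchNumber 0).Stratified := by
  refine .intro (fun _ => 6) ⟨6, 9, stratWith_isZero (k := 0) rfl, stratWith_isSucc (k := 0) rfl, 7,
    ⟨rfl, 6, rfl, 6, stratWith_isAp (k := 5) rfl rfl rfl, rfl⟩, rfl⟩

/-- The set of Church numbers. -/
noncomputable def churchNumbers (w : M.World) : M.Dom w :=
  compr (isChurchNumber 0) stratified_isChurchNumber fun _ => default w

theorem mem_map_churchNumbers {r : M.Hom w w'} {x : M.Dom w'} :
    x ∈ r (churchNumbers w) ↔ ChurchNumber x := by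
  rw [churchNumbers, mem_map_compr, forces_isChurchNumber]; simp

theorem mem_churchNumbers {x : M.Dom w} : x ∈ churchNumbers w ↔ ChurchNumber x := by
  rw [churchNumbers, mem_compr, forces_isChurchNumber]; simp

@[simp] theorem map_churchNumbers (r : M.Hom w w') : r (churchNumbers w) = churchNumbers w' :=
  ext fun w'' s x => by simp only [← map_comp, mem_map_churchNumbers]

@[simp] theorem forces_isN (n : ℕ) (v : ℕ → M.Dom w) :
    Forces M (isN n) v ↔ v n = churchNumbers w := by
  rw [isN, forces_all_iff]
  simp only [forces_isChurchNumber]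
  exact ⟨fun h => ext fun w' r x => by simpa [mem_churchNumbers] using h r x, fun h => by
    simp [h, mem_churchNumbers]⟩

/-! #### The set of finite sets -/

/-- `W` contains the empty set and is closed under adjunction of a new element. -/
def FinClosed (W : M.Dom w) : Prop :=
  empty w ∈ W ∧ ∀ ⦃w'⦄ (r : M.Hom w w') (u c : M.Dom w'), u ∈ r W →
    (∀ ⦃w''⦄ (s : M.Hom w' w''), s c ∉ s u) → adjoin u c ∈ r W

@[simp] theorem forces_isFinClosed (W : ℕ) (v : ℕ → M.Dom w) :
    Forces M (isFinClosed W) v ↔ FinClosed (v W) := by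
  simp [isFinClosed, FinClosed, forces_all_all_imp, forces_neg]

/-- `x` belongs to all sets that contain the empty set and are closed under adjunction of a new
element. -/
def IsFinite (x : M.Dom w) : Prop :=
  ∀ ⦃w'⦄ (r : M.Hom w w') (W : M.Dom w'), FinClosed W → r x ∈ W

theorem forces_isFinite (x : ℕ) (v : ℕ → M.Dom w) :
    Forces M (all (imp (isFinClosed 0) (mem (x + 1) 0))) v ↔ IsFinite (v x) := by
  simp [forces_all_imp, IsFinite]

/-- The set of finite sets. -/
noncomputable def finiteSets (w : M.World) : M.Dom w :=
  compr (all (imp (isFinClosed 0) (mem 1 0)))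
    (.intro (fun _ => 1) ⟨2, ⟨⟨1, ⟨0, rfl, trivial⟩, rfl⟩, 1, 0, ⟨rfl, rfl, trivial⟩, 1,
      ⟨0, by simp [StratWith]⟩, rfl⟩, rfl⟩) fun _ => default w

theorem mem_map_finiteSets {r : M.Hom w w'} {x : M.Dom w'} :
    x ∈ r (finiteSets w) ↔ IsFinite x := by
  rw [finiteSets, mem_map_compr, forces_isFinite 0]; simp

theorem forces_isFINITE (F : ℕ) (v : ℕ → M.Dom w) :
    Forces M (isFINITE F) v ↔ v F = finiteSets w := by
  rw [isFINITE, forces_all_iff]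
  simp only [forces_isFinite 0]
  exact ⟨fun h => ext fun w' r x => by simpa [mem_map_finiteSets] using h r x, fun h => by
    simp [h, mem_map_finiteSets]⟩

/-! #### Iteration -/

/-- `y = j f x` for a function-valued `j`. -/
def Iter (j f x y : M.Dom w) : Prop := ∃ t, IsFunc t ∧ pair f t ∈ j ∧ pair x y ∈ t

/-- The formula expressing `Iter`. -/
def isIter (j f x y : ℕ) : Formula :=
  ex (.and (isFunc 0) (.and (pairMem (f + 1) 0 (j + 1)) (pairMem (x + 1) (y + 1) 0)))

@[simp] theorem forces_isIter (j f x y : ℕ) (v : ℕ → M.Dom w) :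
    Forces M (isIter j f x y) v ↔ Iter (v j) (v f) (v x) (v y) := by
  simp [isIter, Iter]

theorem stratWith_isIter {j f x y k : ℕ} {σ : ℕ → ℕ} (hj : σ j = k + 6) (hf : σ f = k + 3)
    (hx : σ x = k) (hy : σ y = k) : (isIter j f x y).StratWith σ :=
  ⟨k + 3, by simp [StratWith, hj, hf, hx, hy]⟩

theorem Iter.map {j f x y : M.Dom w} (h : Iter j f x y) (r : M.Hom w w') :
    Iter (r j) (r f) (r x) (r y) := by
  obtain ⟨t, ht, hj, hx⟩ := h
  exact ⟨r t, ht.map r, by simpa using mem_map r hj, by simpa using mem_map r hx⟩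

theorem Iter.eq {j f x y z : M.Dom w} (hj : IsFunc j) (hy : Iter j f x y) (hz : Iter j f x z) :
    y = z := by
  obtain ⟨t, ht, hjt, hy⟩ := hy
  obtain ⟨t', -, hjt', hz⟩ := hz
  obtain rfl := hj.eq hjt hjt'
  exact ht.eq hy hz

theorem iter_zero (f x : M.Dom w) : Iter (zero w) f x x :=
  ⟨idFun w, isFunc_idFun, by simp, by simp⟩

theorem iter_succVal {j f x y : M.Dom w} (hj : IsFunc j) (hf : IsFunc f) :
    Iter (succVal j) f x y ↔ ∃ q, Iter j f x q ∧ pair q y ∈ f := by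
  constructor
  · rintro ⟨t, -, h, hxy⟩
    obtain ⟨-, rfl⟩ := pair_mem_succVal.1 h
    obtain ⟨t, q, ht, hjt, hxq, hqy⟩ := pair_mem_succMap.1 hxy
    exact ⟨q, ⟨t, ht, hjt, hxq⟩, hqy⟩
  · rintro ⟨q, ⟨t, ht, hjt, hxq⟩, hqy⟩
    exact ⟨succMap j f, hj.succMap hf, pair_mem_succVal.2 ⟨hf, rfl⟩,
      pair_mem_succMap.2 ⟨t, q, ht, hjt, hxq, hqy⟩⟩

/-! #### Induction on Church numbers -/

theorem mem_of_mem_churchNumbers {X : M.Dom w} (h0 : zero w ∈ X)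
    (hs : ∀ ⦃w'⦄ (r : M.Hom w w') (u : M.Dom w'), u ∈ r X → IsFunc u ∧ succVal u ∈ r X)
    {x : M.Dom w} (hx : x ∈ churchNumbers w) : x ∈ X := by
  simpa using mem_churchNumbers.1 hx (M.id w) X ⟨h0, fun w' r u hu => ⟨succVal u,
    (isFunc_succ.isAp_iff (pair_mem_succ.2 ⟨(hs r u hu).1, rfl⟩)).2 rfl, (hs r u hu).2⟩⟩

/-- S is defined on functions only, so this is needed before `succVal` computes the successor of a
Church number. -/
theorem isFunc_of_mem_churchNumbers {j : M.Dom w} (hj : j ∈ churchNumbers w) : IsFunc j := by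
  have := mem_of_mem_churchNumbers (X := compr (isFunc 0)
    (.intro (fun _ => 3) ((stratWith_isFunc _ _).2 ⟨0, rfl⟩)) fun _ => default w) ?_ ?_ hj
  · simpa [mem_compr] using this
  · simpa [mem_compr] using isFunc_zero
  · intro w' r u hu
    rw [mem_map_compr] at hu ⊢
    exact ⟨by simpa using hu, by simpa using isFunc_succVal u⟩

theorem zero_mem_churchNumbers : zero w ∈ churchNumbers w :=
  mem_churchNumbers.2 fun _ r _ hX => by simpa using hX.1

theorem pair_succVal_mem_succ {j : M.Dom w} (hj : j ∈ churchNumbers w) :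
    pair j (succVal j) ∈ succ w :=
  pair_mem_succ.2 ⟨isFunc_of_mem_churchNumbers hj, rfl⟩

theorem map_mem_churchNumbers {j : M.Dom w} (hj : j ∈ churchNumbers w) (r : M.Hom w w') :
    r j ∈ churchNumbers w' := by
  simpa using mem_map r hj

theorem succVal_mem_churchNumbers {j : M.Dom w} (hj : j ∈ churchNumbers w) :
    succVal j ∈ churchNumbers w := by
  refine mem_churchNumbers.2 fun w' r X hX => ?_
  have hr := map_mem_churchNumbers hj r
  obtain ⟨v, hv, hvX⟩ := hX.2 (M.id w') (r j) (by simpa using mem_churchNumbers.1 hj r X hX)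
  rw [isFunc_succ.isAp_iff (pair_succVal_mem_succ hr)] at hv
  simpa [hv] using hvX

theorem churchNumbers_induction (φ : Formula) (hφ : φ.Stratified) (v : ℕ → M.Dom w)
    (h0 : Forces M φ (scons (zero w) v))
    (hs : ∀ ⦃w'⦄ (r : M.Hom w w') (u : M.Dom w'), u ∈ churchNumbers w' →
      Forces M φ (scons u (M.map r ∘ v)) → Forces M φ (scons (succVal u) (M.map r ∘ v)))
    {x : M.Dom w} (hx : x ∈ churchNumbers w) : Forces M φ (scons x v) := by
  let A := compr φ hφ v
  -- Intersecting with ℕ makes `u ∈ churchNumbers w'` available in the induction step.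
  let X := compr (.and (mem 0 1) (mem 0 2))
    (.intro (scons 0 fun _ => 1) (by simp [StratWith])) (scons A fun _ => churchNumbers w)
  have hX {w'} (r : M.Hom w w') (u : M.Dom w') : u ∈ r X ↔
      Forces M φ (scons u (M.map r ∘ v)) ∧ u ∈ churchNumbers w' := by
    simp only [X, mem_map_compr]
    simp [A, mem_map_compr]
  have key : x ∈ X := by
    refine mem_of_mem_churchNumbers ?_ ?_ hx
    · have := (hX (M.id w) (zero w)).2
      rw [map_id, map_id_comp] at this
      exact this ⟨h0, zero_mem_churchNumbers⟩
    · intro w' r u hu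
      rw [hX] at hu ⊢
      exact ⟨isFunc_of_mem_churchNumbers hu.2, hs r u hu.2 hu.1, succVal_mem_churchNumbers hu.2⟩
  have := (hX (M.id w) x).1 (by simpa using key)
  rw [map_id_comp] at this
  exact this.1

/-! ### Successors are nonzero; existence of iterates. -/

theorem isFunc_empty : IsFunc (empty w) := by
  intro w' r x y z hy
  simp at hy

theorem succVal_ne_zero {j : M.Dom w} (hj : j ∈ churchNumbers w) : succVal j ≠ zero w := by
  intro h
  -- The empty function tells them apart: zero steps of it relate ∅ to ∅, while the last step of a
  -- successor would be a pair in ∅.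
  have h₁ := iter_zero (empty w) (empty w)
  rw [← h, iter_succVal (isFunc_of_mem_churchNumbers hj) isFunc_empty] at h₁
  obtain ⟨q, -, hq⟩ := h₁
  exact not_mem_empty hq

theorem exists_iter {f : M.Dom w} (hf : IsFunc f)
    (hN : ∀ ⦃w'⦄ (r : M.Hom w w') (x : M.Dom w'), x ∈ churchNumbers w' →
      ∃ y ∈ churchNumbers w', pair x y ∈ r f) {j : M.Dom w} (hj : j ∈ churchNumbers w) :
    ∃ y ∈ churchNumbers w, Iter j f (zero w) y := by
  -- The starting point is a parameter of index 0, independent of the induction variable of index 6,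
  -- although both are Church numbers.
  have := churchNumbers_induction (ex (.and (mem 0 2) (isIter 1 3 4 0)))
    (.intro (scons 6 (scons 1 (scons 3 fun _ => 0)))
      ⟨0, rfl, stratWith_isIter (k := 0) rfl rfl rfl rfl⟩)
    (scons (churchNumbers w) (scons f fun _ => zero w)) ?_ ?_ hj
  · simpa using this
  · simpa using ⟨_, zero_mem_churchNumbers, iter_zero f _⟩
  · intro w' r u hu h
    simp only [forces_ex, forces_and, forces_mem, forces_isIter, scons_zero, scons_succ,
      Function.comp_apply, map_churchNumbers, map_zero] at h ⊢
    obtain ⟨y, hy, hyf⟩ := h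
    obtain ⟨z, hz, hyz⟩ := hN r y hy
    exact ⟨z, hz, (iter_succVal (isFunc_of_mem_churchNumbers hu) (hf.map r)).2 ⟨y, hyf, hyz⟩⟩

/-! #### The Church counting axiom -/

/-- `j S 0 = j` for all Church numbers `j`. -/
def Counting (w : M.World) : Prop :=
  ∀ ⦃w'⦄ (_ : M.Hom w w') (j : M.Dom w'), j ∈ churchNumbers w' →
    ∃ q, IsAp q j (succ w') ∧ IsAp j q (zero w')

theorem Counting.map (h : Counting w) (r : M.Hom w w') : Counting w' :=
  fun _ s => h (M.comp r s)

theorem forces_churchCounting {v : ℕ → M.Dom w} (h : Forces M churchCounting v) :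
    Counting w := by
  obtain ⟨N, S, o, hN, hS, ho, h⟩ := h
  rw [forces_isN] at hN
  rw [forces_isSucc] at hS
  rw [forces_isZero] at ho
  simp only [scons_zero, scons_succ] at hN hS ho
  subst hN hS ho
  rw [forces_all_imp] at h
  intro w' r j hj
  simpa using h r j (by simpa using hj)

/-- The axiom speaks of the terms `Ap`, which are genuine values only where the functions are
defined; `exists_iter` provides this. -/
theorem Counting.iter (h : Counting w) {j : M.Dom w} (hj : j ∈ churchNumbers w) :
    Iter j (succ w) (zero w) j := by
  obtain ⟨y, -, t, ht, hjt, hy⟩ := exists_iter isFunc_succ (fun w' r x hx =>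
    ⟨_, succVal_mem_churchNumbers hx, by simpa using pair_succVal_mem_succ hx⟩) hj
  obtain ⟨q, hq, hqj⟩ := h (M.id w) j hj
  rw [(isFunc_of_mem_churchNumbers hj).isAp_iff hjt] at hq
  subst hq
  rw [ht.isAp_iff hy] at hqj
  subst hqj
  exact ⟨q, ht, hjt, hy⟩

/-! #### Finite sets -/

theorem finite_induction (φ : Formula) (hφ : φ.Stratified) (v : ℕ → M.Dom w)
    (h0 : Forces M φ (scons (empty w) v))
    (hs : ∀ ⦃w'⦄ (r : M.Hom w w') (u c : M.Dom w'), Forces M φ (scons u (M.map r ∘ v)) →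
      (∀ ⦃w''⦄ (s : M.Hom w' w''), s c ∉ s u) → Forces M φ (scons (adjoin u c) (M.map r ∘ v)))
    {x : M.Dom w} (hx : IsFinite x) : Forces M φ (scons x v) := by
  have := hx (M.id w) (compr φ hφ v) ⟨(mem_compr ..).2 h0, fun w' r u c hu hc => ?_⟩
  · simpa [mem_compr] using this
  · rw [mem_map_compr] at hu ⊢
    exact hs r u c hu hc

theorem DecEq.adjoin {u c : M.Dom w} (hu : DecEq u)
    (hc : ∀ ⦃w'⦄ (s : M.Hom w w'), s c ∉ s u) : DecEq (adjoin u c) := by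
  intro w' r x y hx hy
  have hc' : ∀ ⦃w''⦄ (s : M.Hom w' w''), s (r c) ∉ s (r u) := fun w'' s => by
    simpa only [← map_comp] using hc (M.comp r s)
  rw [mem_map_adjoin] at hx hy
  rcases hx with hx | rfl <;> rcases hy with hy | rfl
  · exact hu r x y hx hy
  · exact .inr (apart_of_mem hc' hx)
  · exact .inr (apart_of_mem hc' hy).symm
  · exact .inl rfl

theorem IsFinite.decEq {u : M.Dom w} (hu : IsFinite u) : DecEq u := by
  let φ : Formula := all (all (imp (.and (mem 1 2) (mem 0 2)) (.or (eq 1 0) (neg (eq 1 0)))))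
  have hφ {w' : M.World} (u : M.Dom w') (v : ℕ → M.Dom w') :
      Forces M φ (scons u v) ↔ DecEq u := by
    simp [φ, forces_all_all_imp, DecEq]
  refine (hφ u fun _ => u).1 (finite_induction φ (.intro (fun _ => 1)
    ⟨0, 0, by simp [StratWith, neg]⟩) _ ?_ ?_ hu)
  · rw [hφ]
    intro w' r x y hx
    simp at hx
  · intro w' r u c hu hc
    rw [hφ] at hu ⊢
    exact hu.adjoin hc

/-- The relation `g` is injective on `u ∪ {e}`. -/
def InjectiveOn (g u e : M.Dom w) : Prop :=
  ∀ ⦃w'⦄ (r : M.Hom w w') (x y z : M.Dom w'), (x ∈ r u ∨ x = r e) ∧ (y ∈ r u ∨ y = r e) ∧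
    pair x z ∈ r g ∧ pair y z ∈ r g → x = y

/-- The relation `g` relates every element of `u ∪ {e}` to an element of `u` other than `e`. -/
def MapsOmitting (g u e : M.Dom w) : Prop :=
  ∀ ⦃w'⦄ (r : M.Hom w w') (x : M.Dom w'), x ∈ r u ∨ x = r e →
    ∃ y, y ∈ r u ∧ pair x y ∈ r g ∧ Apart y (r e)

/-- The pigeonhole principle for `u`. -/
def Pigeonhole (u : M.Dom w) : Prop :=
  ∀ ⦃w'⦄ (r : M.Hom w w') (g e : M.Dom w'), ¬ (InjectiveOn g (r u) e ∧ MapsOmitting g (r u) e)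

/-- The relation obtained from `g` by composing with itself where it takes the value `c`. -/
noncomputable def bypass (g c : M.Dom w) : M.Dom w :=
  compr (ex (ex (.and (isOPair 2 1 0) (.or (.and (pairMem 1 0 3) (neg (eq 0 4)))
    (.and (pairMem 1 4 3) (pairMem 4 0 3))))))
    (.intro (scons 2 (scons 3 fun _ => 0)) ⟨0, 0, by simp [StratWith, neg]⟩) (scons g fun _ => c)

theorem pair_mem_map_bypass {g c : M.Dom w} {r : M.Hom w w'} {x y : M.Dom w'} :
    pair x y ∈ r (bypass g c) ↔ pair x y ∈ r g ∧ Apart y (r c) ∨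
      pair x (r c) ∈ r g ∧ pair (r c) y ∈ r g := by
  rw [bypass, mem_map_compr]
  simp

/-- A direct value that equals the bypassed value g(c) would force its argument to be `c`, which
lies outside `u ∪ {e}`. -/
theorem InjectiveOn.bypass {g u c e : M.Dom w} (h : InjectiveOn g (adjoin u c) e)
    (hc : ∀ ⦃w'⦄ (s : M.Hom w w'), s c ∉ s u) (he : Apart e c) : InjectiveOn (bypass g c) u e := by
  rintro w' r x y z ⟨hx, hy, hxz, hyz⟩
  have hmem {x : M.Dom w'} (hx : x ∈ r u ∨ x = r e) : x ∈ r (adjoin u c) ∨ x = r e := by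
    rw [mem_map_adjoin]; tauto
  have hne {x : M.Dom w'} (hx : x ∈ r u ∨ x = r e) (hxc : x = r c) : False := by
    rcases hx with hx | rfl
    · exact hc r (hxc ▸ hx)
    · exact he r hxc
  have hc' : r c ∈ r (adjoin u c) ∨ r c = r e := .inl (by simp)
  rw [pair_mem_map_bypass] at hxz hyz
  rcases hxz with ⟨hxz, -⟩ | ⟨hxc, hcz⟩ <;> rcases hyz with ⟨hyz, -⟩ | ⟨hyc, hcz'⟩
  · exact h r x y z ⟨hmem hx, hmem hy, hxz, hyz⟩
  · exact (hne hx (h r x _ z ⟨hmem hx, hc', hxz, hcz'⟩)).elim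
  · exact (hne hy (h r y _ z ⟨hmem hy, hc', hyz, hcz⟩)).elim
  · exact h r x y _ ⟨hmem hx, hmem hy, hxc, hyc⟩

/-- If g(x) = c, the new value is g(c). It is not `c` again, since injectivity would then give x =
c. -/
theorem MapsOmitting.bypass {g u c e : M.Dom w} (h : MapsOmitting g (adjoin u c) e)
    (hg : InjectiveOn g (adjoin u c) e) (hc : ∀ ⦃w'⦄ (s : M.Hom w w'), s c ∉ s u)
    (he : Apart e c) : MapsOmitting (bypass g c) u e := by
  intro w' r x hx
  have hx' : x ∈ r (adjoin u c) ∨ x = r e := by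
    rw [mem_map_adjoin]; tauto
  have hc' : r c ∈ r (adjoin u c) ∨ r c = r e := .inl (by simp)
  simp only [pair_mem_map_bypass]
  obtain ⟨y, hy, hxy, hye⟩ := h r x hx'
  rcases mem_map_adjoin.1 hy with hy | rfl
  · exact ⟨y, hy, .inl ⟨hxy, apart_of_mem (fun w'' s => by
      simpa only [← map_comp] using hc (M.comp r s)) hy⟩, hye⟩
  obtain ⟨z, hz, hcz, hze⟩ := h r (r c) hc'
  rcases mem_map_adjoin.1 hz with hz | rfl
  · exact ⟨z, hz, .inr ⟨hxy, hcz⟩, hze⟩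
  obtain rfl := hg r x (r c) _ ⟨hx', hc', hxy, hcz⟩
  exact (hx.elim (hc r) fun h => he r h.symm).elim

theorem Pigeonhole.adjoin {u c : M.Dom w} (hu : Pigeonhole u)
    (hc : ∀ ⦃w'⦄ (s : M.Hom w w'), s c ∉ s u) : Pigeonhole (adjoin u c) := by
  rintro w' r g e ⟨hg, hm⟩
  rw [map_adjoin] at hg hm
  by_cases h : Apart e (r c)
  · have hc' : ∀ ⦃w''⦄ (s : M.Hom w' w''), s (r c) ∉ s (r u) := fun w'' s => by
      simpa only [← map_comp] using hc (M.comp r s)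
    exact hu r _ e ⟨hg.bypass hc' h, hm.bypass hg hc' h⟩
  -- Here `e` and `c` become equal at some later world. There `u ∪ {c}` is `u ∪ {e}` and omitting
  -- `e` means omitting `c`, so `g` itself contradicts the principle for `u`.
  · simp only [Apart, not_forall, ne_eq, not_not] at h
    obtain ⟨w'', s, hs⟩ := h
    refine hu (M.comp r s) (s g) (s e) ⟨?_, ?_⟩
    · rintro w₃ t x y z ⟨hx, hy, hxz, hyz⟩
      simp only [map_comp] at hx hy
      rw [← map_comp] at hxz hyz
      refine hg (M.comp s t) x y z ⟨?_, ?_, hxz, hyz⟩ <;>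
        simp only [map_comp, map_adjoin, mem_adjoin] <;> tauto
    · intro w₃ t x hx
      simp only [map_comp] at hx
      obtain ⟨y, hy, hxy, hye⟩ := hm (M.comp s t) x (by
        simp only [map_comp, map_adjoin, mem_adjoin]; tauto)
      simp only [map_comp, map_adjoin, mem_adjoin] at hy hxy hye
      refine ⟨y, ?_, hxy, hye⟩
      rw [map_comp]
      exact hy.resolve_right fun h => hye.ne (h.trans (by rw [hs]))

theorem IsFinite.pigeonhole {u : M.Dom w} (hu : IsFinite u) : Pigeonhole u := by
  let φ : Formula := all (all (imp (.and
    (all (all (all (imp (.and (.or (mem 2 5) (eq 2 3)) (.and (.or (mem 1 5) (eq 1 3))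
      (.and (pairMem 2 0 4) (pairMem 1 0 4)))) (eq 2 1)))))
    (all (imp (.or (mem 0 3) (eq 0 1))
      (ex (.and (mem 0 4) (.and (pairMem 1 0 3) (neg (eq 0 2)))))))) bot))
  have hφ {w' : M.World} (u : M.Dom w') (v : ℕ → M.Dom w') :
      Forces M φ (scons u v) ↔ Pigeonhole u := by
    simp only [φ, forces_all_all_imp, forces_all_all_all_imp, forces_all_imp, forces_and]
    simp [Pigeonhole, InjectiveOn, MapsOmitting]
  refine (hφ u fun _ => u).1 (finite_induction φ (.intro (fun _ => 1)
    ⟨3, 0, ⟨⟨0, 0, 0, by simp [StratWith]⟩, 0, by simp [StratWith, neg]⟩, trivial⟩) _ ?_ ?_ hu)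
  · rw [hφ]
    rintro w' r g e ⟨-, h⟩
    obtain ⟨y, hy, -⟩ := h (M.id w') e (by simp)
    simp at hy
  · intro w' r u c hu hc
    rw [hφ] at hu ⊢
    exact hu.adjoin hc

/-! #### Injectivity of Church successor -/

/-- Church successor on the Church numbers, modified to take the value `0` at `b`. -/
noncomputable def modified (b : M.Dom w) : M.Dom w :=
  compr (ex (ex (.and (isOPair 2 1 0) (.and (mem 1 3) (.or (.and (neg (eq 1 5)) (pairMem 1 0 4))
    (.and (eq 1 5) (eq 0 6)))))))
    (.intro (scons 2 (scons 1 (scons 3 fun _ => 0))) ⟨0, 0, by simp [StratWith, neg]⟩)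
    (scons (churchNumbers w) (scons (succ w) (scons b fun _ => zero w)))

theorem mem_map_modified {b : M.Dom w} {r : M.Hom w w'} {p : M.Dom w'} :
    p ∈ r (modified b) ↔ ∃ x y, p = pair x y ∧ x ∈ churchNumbers w' ∧
      (Apart x (r b) ∧ pair x y ∈ succ w' ∨ x = r b ∧ y = zero w') := by
  rw [modified, mem_map_compr]; simp

theorem pair_mem_modified {b x y : M.Dom w} : pair x y ∈ modified b ↔ x ∈ churchNumbers w ∧
    (Apart x b ∧ pair x y ∈ succ w ∨ x = b ∧ y = zero w) := by
  rw [modified, mem_compr]; simp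

@[simp] theorem map_modified (r : M.Hom w w') (b : M.Dom w) : r (modified b) = modified (r b) :=
  ext fun w'' s x => by simp only [← map_comp, mem_map_modified]

theorem isFunc_modified (b : M.Dom w) : IsFunc (modified b) := by
  intro w' r x y z hy hz
  rw [map_modified, pair_mem_modified] at hy hz
  rcases hy.2 with ⟨h, hy⟩ | ⟨h, hy⟩ <;> rcases hz.2 with ⟨h', hz⟩ | ⟨h', hz⟩
  · exact isFunc_succ.eq hy hz
  · exact (h.ne h').elim
  · exact (h'.ne h).elim
  · rw [hy, hz]

theorem pair_succVal_mem_modified {b x : M.Dom w} (hx : x ∈ churchNumbers w) (h : Apart x b) :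
    pair x (succVal x) ∈ modified b :=
  pair_mem_modified.2 ⟨hx, .inl ⟨h, pair_succVal_mem_succ hx⟩⟩

theorem DecEq.eq_or_apart (hD : DecEq (churchNumbers w)) {x y : M.Dom w}
    (hx : x ∈ churchNumbers w) (hy : y ∈ churchNumbers w) : x = y ∨ Apart x y :=
  hD (M.id w) x y (by simpa using hx) (by simpa using hy)

/-- The first disjunct says that `b` has not been passed yet, so `modified b` still runs along with
S. When u = b, counting shows that the common value is `b`; this is the second disjunct, which no
longer depends on `u`. -/
theorem iter_modified_self_step (hC : Counting w) (hD : DecEq (churchNumbers w)) {b u : M.Dom w}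
    (hb : b ∈ churchNumbers w) (hu : u ∈ churchNumbers w)
    (h : (∃ y, Iter u (modified b) (zero w) y ∧ Iter u (succ w) (zero w) y) ∨
      Iter b (modified b) (zero w) b) :
    (∃ y, Iter (succVal u) (modified b) (zero w) y ∧ Iter (succVal u) (succ w) (zero w) y) ∨
      Iter b (modified b) (zero w) b := by
  rcases h with ⟨y, hf, hy⟩ | h
  · have hu' := isFunc_of_mem_churchNumbers hu
    obtain rfl := hy.eq hu' (hC.iter hu)
    rcases hD.eq_or_apart hu hb with rfl | hub
    · exact .inr hf
    · exact .inl ⟨succVal y,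
        (iter_succVal hu' (isFunc_modified b)).2 ⟨y, hf, pair_succVal_mem_modified hu hub⟩,
        (iter_succVal hu' isFunc_succ).2 ⟨y, hy, pair_succVal_mem_succ hu⟩⟩
  · exact .inr h

theorem iter_modified_self (hC : Counting w) (hD : DecEq (churchNumbers w)) {b : M.Dom w}
    (hb : b ∈ churchNumbers w) : Iter b (modified b) (zero w) b := by
  -- `b` enters as two parameters: as the number of steps it has index 6, as the value reached it
  -- has index 0.
  have := churchNumbers_induction
    (.or (ex (.and (isIter 1 2 4 0) (isIter 1 3 4 0))) (isIter 4 1 3 5))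
    (.intro (scons 6 (scons 3 (scons 3 (scons 0 (scons 6 fun _ => 0)))))
      ⟨⟨0, stratWith_isIter (k := 0) rfl rfl rfl rfl, stratWith_isIter (k := 0) rfl rfl rfl rfl⟩,
        stratWith_isIter (k := 0) rfl rfl rfl rfl⟩)
    (scons (modified b) (scons (succ w) (scons (zero w) (scons b fun _ => b)))) ?_ ?_ hb
  · simp only [forces_or, forces_ex, forces_and, forces_isIter, scons_zero, scons_succ] at this
    rcases this with ⟨y, hf, hy⟩ | h
    · obtain rfl := hy.eq (isFunc_of_mem_churchNumbers hb) (hC.iter hb)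
      exact hf
    · exact h
  · exact .inl ⟨zero w, by simpa using ⟨iter_zero _ _, iter_zero _ _⟩⟩
  · intro w' r u hu h
    have hD' := hD.map r
    rw [map_churchNumbers] at hD'
    simp only [forces_or, forces_ex, forces_and, forces_isIter, scons_zero, scons_succ,
      Function.comp_apply, map_modified, map_succ, map_zero] at h ⊢
    exact iter_modified_self_step (hC.map r) hD' (map_mem_churchNumbers hb r) hu h

/-- Running `modified b` from 0 for S b = S a steps ends in 0. Its last step must start at `b`, the
only argument with value 0. -/
theorem iter_modified_of_succVal_eq (hC : Counting w) (hD : DecEq (churchNumbers w))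
    {a b : M.Dom w} (ha : a ∈ churchNumbers w) (hb : b ∈ churchNumbers w)
    (h : succVal a = succVal b) : Iter a (modified b) (zero w) b := by
  have h₁ : Iter (succVal b) (modified b) (zero w) (zero w) :=
    (iter_succVal (isFunc_of_mem_churchNumbers hb) (isFunc_modified b)).2
      ⟨b, iter_modified_self hC hD hb, pair_mem_modified.2 ⟨hb, .inr ⟨rfl, rfl⟩⟩⟩
  rw [← h, iter_succVal (isFunc_of_mem_churchNumbers ha) (isFunc_modified b)] at h₁
  obtain ⟨q, hq, hq0⟩ := h₁
  obtain ⟨hqN, ⟨-, hqs⟩ | ⟨rfl, -⟩⟩ := pair_mem_modified.1 hq0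
  · exact (succVal_ne_zero hqN (pair_mem_succ.1 hqs).2.symm).elim
  · exact hq

/-- Both modified maps act as S on `u`, because `u` is neither `a` nor `b`: at `a` the iterate of
`modified b` would be both `a` and `b`, and symmetrically at `b`. -/
theorem iter_modified_step (hC : Counting w) (hD : DecEq (churchNumbers w)) {a b u : M.Dom w}
    (ha : a ∈ churchNumbers w) (hb : b ∈ churchNumbers w) (hab : Apart a b)
    (hs : succVal a = succVal b) (hu : u ∈ churchNumbers w)
    (h : ∃ y, Iter u (modified b) (zero w) y ∧ Iter u (modified a) (zero w) y ∧
      Iter u (succ w) (zero w) y) :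
    ∃ y, Iter (succVal u) (modified b) (zero w) y ∧ Iter (succVal u) (modified a) (zero w) y ∧
      Iter (succVal u) (succ w) (zero w) y := by
  obtain ⟨y, hf, hg, hy⟩ := h
  have hu' := isFunc_of_mem_churchNumbers hu
  obtain rfl := hy.eq hu' (hC.iter hu)
  rcases hD.eq_or_apart hu ha with rfl | hua
  · exact (hab.ne (hf.eq hu' (iter_modified_of_succVal_eq hC hD ha hb hs))).elim
  rcases hD.eq_or_apart hu hb with rfl | hub
  · exact (hab.ne.symm (hg.eq hu' (iter_modified_of_succVal_eq hC hD hb ha hs.symm))).elim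
  exact ⟨succVal y,
    (iter_succVal hu' (isFunc_modified b)).2 ⟨y, hf, pair_succVal_mem_modified hu hub⟩,
    (iter_succVal hu' (isFunc_modified a)).2 ⟨y, hg, pair_succVal_mem_modified hu hua⟩,
    (iter_succVal hu' isFunc_succ).2 ⟨y, hy, pair_succVal_mem_succ hu⟩⟩

/-- Church successor is injective, if the Church counting axiom holds and equality of Church
numbers is decidable. -/
theorem succVal_injective (hC : Counting w) (hD : DecEq (churchNumbers w)) {a b : M.Dom w}
    (ha : a ∈ churchNumbers w) (hb : b ∈ churchNumbers w) (hs : succVal a = succVal b) :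
    a = b := by
  refine (hD.eq_or_apart ha hb).resolve_right fun hab => ?_
  have := churchNumbers_induction
    (ex (.and (isIter 1 2 5 0) (.and (isIter 1 3 5 0) (isIter 1 4 5 0))))
    (.intro (scons 6 (scons 3 (scons 3 (scons 3 fun _ => 0))))
      ⟨0, stratWith_isIter (k := 0) rfl rfl rfl rfl, stratWith_isIter (k := 0) rfl rfl rfl rfl,
        stratWith_isIter (k := 0) rfl rfl rfl rfl⟩)
    (scons (modified b) (scons (modified a) (scons (succ w) fun _ => zero w))) ?_ ?_ ha
  · simp only [forces_ex, forces_and, forces_isIter, scons_zero, scons_succ] at this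
    obtain ⟨y, hf, -, hy⟩ := this
    have ha' := isFunc_of_mem_churchNumbers ha
    obtain rfl := hy.eq ha' (hC.iter ha)
    -- After `a` steps `modified b` has reached `a` by the induction and `b` by the equality of
    -- successors.
    exact hab.ne (hf.eq ha' (iter_modified_of_succVal_eq hC hD ha hb hs))
  · exact ⟨zero w, by simpa using ⟨iter_zero _ _, iter_zero _ _, iter_zero _ _⟩⟩
  · intro w' r u hu h
    have hD' := hD.map r
    rw [map_churchNumbers] at hD'
    simp only [forces_ex, forces_and, forces_isIter, scons_zero, scons_succ,
      Function.comp_apply, map_modified, map_succ, map_zero] at h ⊢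
    exact iter_modified_step (hC.map r) hD' (map_mem_churchNumbers ha r)
      (map_mem_churchNumbers hb r) (hab.map r)
      (by simpa using congrArg r hs) hu h

/-- The Church counting axiom implies that the set of Church numbers is not finite. -/
theorem Counting.not_isFinite (hC : Counting w) : ¬ IsFinite (churchNumbers w) := by
  intro hN
  have hN' {w'} {r : M.Hom w w'} {x : M.Dom w'}
      (hx : x ∈ r (M.id w (churchNumbers w)) ∨ x = r (zero w)) : x ∈ churchNumbers w' := by
    rcases hx with hx | rfl
    · simpa using hx
    · simpa using zero_mem_churchNumbers
  -- With `e` taken to be 0, which is already in ℕ, the set `u ∪ {e}` is ℕ, and S would inject ℕ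
  -- into ℕ without 0.
  refine hN.pigeonhole (M.id w) (succ w) (zero w) ⟨?_, ?_⟩
  · rintro w' r x y z ⟨hx, hy, hxz, hyz⟩
    have hD := hN.decEq.map r
    rw [map_churchNumbers] at hD
    rw [map_succ, pair_mem_succ] at hxz hyz
    exact succVal_injective (hC.map r) hD (hN' hx) (hN' hy) (hxz.2.symm.trans hyz.2)
  · intro w' r x hx
    have hx := hN' hx
    refine ⟨succVal x, by simpa using succVal_mem_churchNumbers hx,
      by simpa using pair_succVal_mem_succ hx, fun w'' s => ?_⟩
    simpa using succVal_ne_zero (map_mem_churchNumbers hx s)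

theorem Counting.forces_not_finite (hC : Counting w) (v : ℕ → M.Dom w) :
    Forces M churchNumbersNotFinite v := by
  refine ⟨churchNumbers w, finiteSets w, (forces_isN ..).2 rfl, (forces_isFINITE ..).2 rfl, ?_⟩
  rw [forces_neg]
  intro w' r h
  simp only [forces_mem, Function.comp_apply, scons_zero, scons_succ, map_churchNumbers,
    mem_map_finiteSets] at h
  exact (hC.map r).not_isFinite h

end Models

end INF

/-- INF proves, with intuitionistic logic, that the Church counting axiom implies that the
set of Church numbers is not finite. -/
theorem mainTheorem1 :
    INF.Derives INF.theory []
      (INF.Formula.imp INF.churchCounting INF.churchNumbersNotFinite) := by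
  refine INF.derives_of_forces fun M hM w v w' r h => ?_
  have : INF.IsModel M := ⟨hM⟩
  exact (INF.forces_churchCounting h).forces_not_finite _
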